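/- Consider equations of the form \[ u_t+uu_x=A^2(t,x)u_{xx}+A^1(t,x)u_x . \tag{1} \] Let $\hat{\mathcal L}$ be the class of all equations (1) whose coefficients (arbitrary elements) $A^1,A^2$ are smooth real functions of $(t,x)$ with $A^2$ nowhere zero, and let $\hat{\mathcal L}_1$ be its subclass singled out by $A^1_{xx}\ne0$, i.e. $A^1_{xx}$ does not vanish identically. Work locally: a domain is a nonempty connected open set $\Omega\subseteq\mathbb R^3$ of points $(t,x,u)$ all of whose sections $t=\mathrm{const}$ are connected, and the arbitrary elements are then defined on the projection of $\Omega$ to the $(t,x)$-plane. An admissible transformation of a class $\mathcal C$ of equations (1) is a triple $(\theta,\varphi,\tilde\theta)$, where $\theta=(A^1,A^2)$ and $\tilde\theta=(\tilde A^1,\tilde A^2)$ belong to $\mathcal C$ on domains $\Omega$ and $\tilde\Omega$, and $\varphi\colon\Omega\to\tilde\Omega$ is a smooth diffeomorphism (a point transformation of $(t,x,u)$) whose second prolongation, wherever it is defined, maps the equation with coefficients $\theta$, as a subset of the second-order jet space, to the one with coefficients $\tilde\theta$. The usual equivalence group of $\mathcal C$ consists of the local diffeomorphisms $\Phi$ of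 the space with coordinates $(t,x,u,A^1,A^2)$, $A^2\ne0$, whose $(t,x,u)$-components form a point transformation $\varphi\colon\Omega\to\tilde\Omega$ depending on $(t,x,u)$ only, whose $(A^1,A^2)$-components are defined over $\Omega$ for all values of $A^1$ and all $A^2\neq0$, and which map each $\theta\in\mathcal C$ on $\Omega$ to some $\tilde\theta\in\mathcal C$ on $\tilde\Omega$ such that $(\theta,\varphi,\tilde\theta)$ is an admissible transformation. The class $\mathcal C$ is normalized in the usual sense if its admissible transformations are exactly those induced in this way by elements of its usual equivalence group. Then the class $\hat{\mathcal L}_1$ is normalized in the usual sense, and its usual equivalence group coincides with the usual equivalence group $\hat G^\sim$ of the class $\hat{\mathcal L}$. The group $\hat G^\sim$ consists of the transformations \[ \tilde t=T,\quad \tilde x=T_tU^1x+X^0,\quad \tilde u=U^1u+U^0,\quad \tilde A^1=U^1A^1+U^0-\frac{T_{tt}U^1x+X^0_t}{T_t},\quad \tilde A^2=T_t(U^1)^2A^2, \] where $T$ and $X^0$ are arbitrary smooth functions of $t$ with $T_t\ne0$, and $U^0$ and $U^1$ are arbitrary constants with $U^1\ne0$. The same assertions on $\hat{\mathcal L}_1$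 hold if the constraint $A^1_{xx}\ne0$ is understood as $A^1_{xx}$ vanishing nowhere. -/

import Mathlib

open Set Filter Topology
open scoped ContDiff

namespace Burgers

/-- The plane of the independent variables `(t, x)`. -/
abbrev Plane := ℝ × ℝ

/-- The space of the independent and dependent variables `(t, x, u)`. -/
abbrev Space := ℝ × ℝ × ℝ

/-- The projection `(t, x, u) ↦ (t, x)`. -/
def base (p : Space) : Plane := (p.1, p.2.1)

/-- Partial derivative with respect to the first variable `t`. -/
noncomputable def dt (f : Plane → ℝ) (q : Plane) : ℝ := fderiv ℝ f q (1, 0)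

/-- Partial derivative with respect to the second variable `x`. -/
noncomputable def dx (f : Plane → ℝ) (q : Plane) : ℝ := fderiv ℝ f q (0, 1)

/-- A pair of arbitrary elements `(A¹, A²)`, regarded as functions of `(t, x)`.
Only the values on the domain under consideration matter. -/
structure Coeffs where
  A1 : Plane → ℝ
  A2 : Plane → ℝ

/-- The value at `q` of `u_t + u u_x - A² u_xx - A¹ u_x` for the function `u = f`. -/
noncomputable def residual (θ : Coeffs) (f : Plane → ℝ) (q : Plane) : ℝ :=
  dt f q + f q * dx f q - θ.A2 q * dx (dx f) q - θ.A1 q * dx f q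

/-- A class of equations `u_t + u u_x = A² u_xx + A¹ u_x`: it prescribes, for each domain in the
`(t, x)`-plane, the set of admitted pairs of arbitrary elements on this domain. -/
abbrev EqClass := Set Plane → Set Coeffs

/-- The whole class: `A¹`, `A²` are smooth and `A²` does not vanish. -/
def wholeClass : EqClass := fun D =>
  {θ | ContDiffOn ℝ ∞ θ.A1 D ∧ ContDiffOn ℝ ∞ θ.A2 D ∧ ∀ q ∈ D, θ.A2 q ≠ 0}

/-- The regular subclass: `A¹_xx` is not identically zero, i.e. the complement in the whole class
of the singular subclass `A¹_xx = 0`. -/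
def regularClass : EqClass := fun D =>
  {θ | θ ∈ wholeClass D ∧ ∃ q ∈ D, dx (dx θ.A1) q ≠ 0}

/-- The regular subclass when `A¹_xx ≠ 0` is read pointwise: `A¹_xx` vanishes nowhere. -/
def strictlyRegularClass : EqClass := fun D =>
  {θ | θ ∈ wholeClass D ∧ ∀ q ∈ D, dx (dx θ.A1) q ≠ 0}

/-- Domains in the `(t, x, u)`-space: nonempty connected open sets all of whose sections by
`t = const` are connected, so that a smooth function of `(t, x, u)` with vanishing derivatives in
`x` and `u` is a function of `t`. -/
structure IsDom (Ω : Set Space) : Prop where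
  isOpen : IsOpen Ω
  isConnected : IsConnected Ω
  slice : ∀ t : ℝ, IsPreconnected {q : ℝ × ℝ | (t, q) ∈ Ω}

/-- `f` restricts to a smooth diffeomorphism of `S` onto `S'`. -/
def IsDiffeo {E F : Type*} [NormedAddCommGroup E] [NormedSpace ℝ E]
    [NormedAddCommGroup F] [NormedSpace ℝ F] (f : E → F) (S : Set E) (S' : Set F) : Prop :=
  ContDiffOn ℝ ∞ f S ∧ MapsTo f S S' ∧
    ∃ g : F → E, ContDiffOn ℝ ∞ g S' ∧ MapsTo g S' S ∧ InvOn g f S S'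

/-- The point transformation `φ`, defined on `Ω`, maps the equation with coefficients `θ` to the
equation with coefficients `θ'`: its second prolongation maps the submanifold of the second-order
jet space given by the first equation to the one given by the second equation.

Second-order jets are represented by functions. `f` is a smooth function near `q` whose graph at
`q` lies in `Ω`; the map `(t, x) ↦ (t̃, x̃)` obtained by restricting `φ` to the graph of `f` has a
nonzero Jacobian at `q`, so that the prolongation of `φ` is defined at the jet of `f`; and `f'` is
the transformed function `ũ(t̃, x̃)`, whose graph is the image of the graph of `f`. The jet of `f` at
`q` satisfies the first equation iff the jet of `f'` at the image of `q` satisfies the second. -/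
def MapsEquation (Ω : Set Space) (φ : Space → Space) (θ θ' : Coeffs) : Prop :=
  ∀ (q : Plane) (f f' : Plane → ℝ),
    let G : Plane → Space := fun r => φ (r.1, r.2, f r)
    ContDiffAt ℝ ∞ f q → (q.1, q.2, f q) ∈ Ω →
    dt (fun r => (G r).1) q * dx (fun r => (G r).2.1) q
      - dx (fun r => (G r).1) q * dt (fun r => (G r).2.1) q ≠ 0 →
    ContDiffAt ℝ ∞ f' (base (G q)) → (∀ᶠ r in 𝓝 q, f' (base (G r)) = (G r).2.2) →
    (residual θ f q = 0 ↔ residual θ' f' (base (G q)) = 0)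

/-- `(θ, φ, θ')` is an admissible transformation of the class `C`, with source domain `Ω` and
target domain `Ω'`: `φ` is a point transformation relating two equations of the class. -/
structure IsAdmissible (C : EqClass) (Ω Ω' : Set Space) (θ : Coeffs) (φ : Space → Space)
    (θ' : Coeffs) : Prop where
  dom : IsDom Ω
  dom' : IsDom Ω'
  diffeo : IsDiffeo φ Ω Ω'
  mem : θ ∈ C (base '' Ω)
  mem' : θ' ∈ C (base '' Ω')
  maps : MapsEquation Ω φ θ θ'

/-- Data of a (local) transformation in the space with coordinates `(t, x, u, A¹, A²)` whose
`(t, x, u)`-components depend on `(t, x, u)` only. -/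
structure Transf where
  /-- the domain in the `(t, x, u)`-space -/
  source : Set Space
  /-- the range in the `(t, x, u)`-space -/
  target : Set Space
  /-- the components for `(t, x, u)` -/
  pt : Space → Space
  /-- the components for `(A¹, A²)`, functions of `(t, x, u, A¹, A²)` -/
  el : Space × (ℝ × ℝ) → ℝ × ℝ

/-- The part of the space `(t, x, u, A¹, A²)` over `Ω`, where `A² ≠ 0`. -/
def totalSet (Ω : Set Space) : Set (Space × (ℝ × ℝ)) := {z | z.1 ∈ Ω ∧ z.2.2 ≠ 0}

/-- The transformation in the space `(t, x, u, A¹, A²)`. -/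
def Transf.total (Φ : Transf) (z : Space × (ℝ × ℝ)) : Space × (ℝ × ℝ) := (Φ.pt z.1, Φ.el z)

/-- `Φ` transforms the arbitrary elements `θ` to `θ'`; the left-hand side is evaluated at the new
variables and the right-hand side at the old ones. -/
def Transf.MapsCoeffs (Φ : Transf) (θ θ' : Coeffs) : Prop :=
  ∀ p ∈ Φ.source, (θ'.A1 (base (Φ.pt p)), θ'.A2 (base (Φ.pt p)))
    = Φ.el (p, (θ.A1 (base p), θ.A2 (base p)))

/-- The usual equivalence (pseudo)group of the class `C`: the point transformations in the space
`(t, x, u, A¹, A²)`, projectable to the space `(t, x, u)`, that map each equation of the class to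
an equation of the class. -/
def usualEquivGroup (C : EqClass) : Set Transf :=
  {Φ | IsDom Φ.source ∧ IsDom Φ.target ∧ IsDiffeo Φ.pt Φ.source Φ.target ∧
    IsDiffeo Φ.total (totalSet Φ.source) (totalSet Φ.target) ∧
    ∀ θ ∈ C (base '' Φ.source), ∃ θ' ∈ C (base '' Φ.target),
      Φ.MapsCoeffs θ θ' ∧ MapsEquation Φ.source Φ.pt θ θ'}

/-- The class `C` is normalized in the usual sense: its equivalence groupoid, i.e. the set of its
admissible transformations, is the one generated by the usual equivalence group. -/
def IsNormalizedUsual (C : EqClass) : Prop :=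
  ∀ (Ω Ω' : Set Space) (θ : Coeffs) (φ : Space → Space) (θ' : Coeffs),
    IsAdmissible C Ω Ω' θ φ θ' ↔
      θ ∈ C (base '' Ω) ∧ ∃ Φ ∈ usualEquivGroup C,
        Φ.source = Ω ∧ Φ.target = Ω' ∧ EqOn Φ.pt φ Ω ∧ Φ.MapsCoeffs θ θ'

/-- The explicit transformations
`t̃ = T`, `x̃ = T_t U¹ x + X⁰`, `ũ = U¹ u + U⁰`,
`Ã¹ = U¹ A¹ + U⁰ - (T_tt U¹ x + X⁰_t) / T_t`, `Ã² = T_t (U¹)² A²`,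
with smooth functions `T`, `X⁰` of `t`, constants `U⁰`, `U¹`, and `T_t U¹ ≠ 0`. -/
def explicitGroup : Set Transf :=
  {Φ | IsDom Φ.source ∧ Φ.target = Φ.pt '' Φ.source ∧
    ∃ (T X0 : ℝ → ℝ) (U0 U1 : ℝ),
      ContDiffOn ℝ ∞ T (Prod.fst '' Φ.source) ∧ ContDiffOn ℝ ∞ X0 (Prod.fst '' Φ.source) ∧
      (∀ t ∈ Prod.fst '' Φ.source, deriv T t ≠ 0) ∧ U1 ≠ 0 ∧
      ∀ t x u : ℝ, (t, x, u) ∈ Φ.source →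
        Φ.pt (t, x, u) = (T t, deriv T t * U1 * x + X0 t, U1 * u + U0) ∧
        ∀ a1 a2 : ℝ, a2 ≠ 0 →
          Φ.el ((t, x, u), (a1, a2)) =
            (U1 * a1 + U0 - (deriv (deriv T) t * U1 * x + deriv X0 t) / deriv T t,
              deriv T t * U1 ^ 2 * a2)}

end Burgers

/-! Write `φ = (T, X, U)`, with subscripts for partial derivatives. A point transformation is tested
on second-order jets: at a point of `Ω` the derivatives of `u` can be prescribed freely, subject
only to the source equation, and the transformed equation must then hold. The argument splits it
with respect to these free parameters.

The second derivative `ũ_x̃x̃` is taken along the direction of the graph that is mapped to the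
`x̃`-direction. If `T_x` or `T_u` were nonzero, a suitable jet would give this direction a
`t`-component, and `u_tt`, which is absent from the source equation, would occur in the target one
(`MapsEquation.cT_indep`). Varying `u_t` next gives `A² (X_x + u_x X_u)² = Ã² T_t` for almost all
`u_x`, whence `X_u = 0` (`MapsEquation.cX_indep`). What remains is a quadratic polynomial in `u_x`,
whose coefficients are the determining equations (`MapsEquation.determining`).

The coefficients `A¹`, `A²` and the pullback of `Ã¹` do not depend on `u`, so differentiation in `u`
and `x` yields `X_x = T_t U_u`, `U_xu = 0`, `U_tu = -U_x`, `U_tx = A¹_x U_x` and finally `U_x A¹_xx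
= 0` (`solve_determining`). Only the last relation calls for regularity: `U_x` vanishes where `A¹_xx
≠ 0`, and since it solves a homogeneous linear equation in `t` and has zero derivatives in `x` and
`u`, it vanishes on the whole connected domain (`eq_zero_of_linear_ode`). Hence one point with
`A¹_xx ≠ 0` is enough. Then `U_t = 0`, `U_u` is constant, and integration gives the explicit form.

Conversely, for an explicit transformation the two residuals differ by a nonvanishing factor
(`ExplicitForm.mapsEquation`), and `Ã¹_xx` is a nonvanishing multiple of `A¹_xx`
(`ExplicitForm.exists_coeffs`), so all three classes are preserved. Each class contains equations
with `A¹` quadratic in `x`. They determine the point part of any equivalence transformation and, as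
their values at a point are arbitrary, its action on `(A¹, A²)` too. This gives one group for all
three classes; for the regular ones the same rigidity applies to every admissible transformation,
which is normalization. -/

namespace Burgers

/-! ### Calculus of directional derivatives -/

section Calculus

variable {E : Type*} [NormedAddCommGroup E] [NormedSpace ℝ E]

/-- The derivative of `F` at `p` in the constant direction `v`. -/
noncomputable def pd (v : E) (F : E → ℝ) (p : E) : ℝ := fderiv ℝ F p v

lemma dt_eq_pd (f : Plane → ℝ) : dt f = pd (1, 0) f := rfl

lemma dx_eq_pd (f : Plane → ℝ) : dx f = pd (0, 1) f := rfl

lemma contDiffAt_pd {F : E → ℝ} {p : E} (h : ContDiffAt ℝ ∞ F p) (v : E) :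
    ContDiffAt ℝ ∞ (pd v F) p :=
  (h.fderiv_right (m := ∞) (by simp)).clm_apply contDiffAt_const

lemma diffAt {F : E → ℝ} {p : E} (h : ContDiffAt ℝ ∞ F p) : DifferentiableAt ℝ F p :=
  h.differentiableAt (by simp)

lemma pd_add_dir (v w : E) (F : E → ℝ) (p : E) : pd (v + w) F p = pd v F p + pd w F p := by
  simp [pd]

lemma pd_smul_dir (c : ℝ) (v : E) (F : E → ℝ) (p : E) : pd (c • v) F p = c * pd v F p := by
  simp [pd]

lemma pd_const (v : E) (c : ℝ) (p : E) : pd v (fun _ => c) p = 0 := by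
  simp [pd]

lemma pd_add {F G : E → ℝ} {p : E} (hF : ContDiffAt ℝ ∞ F p) (hG : ContDiffAt ℝ ∞ G p) (v : E) :
    pd v (fun r => F r + G r) p = pd v F p + pd v G p := by
  simp [pd, fderiv_fun_add (diffAt hF) (diffAt hG)]

lemma pd_sub {F G : E → ℝ} {p : E} (hF : ContDiffAt ℝ ∞ F p) (hG : ContDiffAt ℝ ∞ G p) (v : E) :
    pd v (fun r => F r - G r) p = pd v F p - pd v G p := by
  simp [pd, fderiv_fun_sub (diffAt hF) (diffAt hG)]

lemma pd_mul {F G : E → ℝ} {p : E} (hF : ContDiffAt ℝ ∞ F p) (hG : ContDiffAt ℝ ∞ G p) (v : E) :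
    pd v (fun r => F r * G r) p = pd v F p * G p + F p * pd v G p := by
  simp [pd, fderiv_fun_mul (diffAt hF) (diffAt hG)]
  ring

lemma pd_const_mul {F : E → ℝ} {p : E} (hF : ContDiffAt ℝ ∞ F p) (c : ℝ) (v : E) :
    pd v (fun r => c * F r) p = c * pd v F p := by
  rw [pd_mul contDiffAt_const hF, pd_const]
  ring

lemma pd_congr_nhds {F G : E → ℝ} {p : E} (h : ∀ᶠ r in 𝓝 p, F r = G r) (v : E) :
    pd v F p = pd v G p := by
  simp [pd, EventuallyEq.fderiv_eq h]

lemma pd_congr {F G : E → ℝ} {Ω : Set E} (hΩ : IsOpen Ω) (h : ∀ p ∈ Ω, F p = G p) (v : E) :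
    ∀ p ∈ Ω, pd v F p = pd v G p := fun _ hp =>
  pd_congr_nhds (Filter.mem_of_superset (hΩ.mem_nhds hp) h) v

lemma pd_eq_zero {F : E → ℝ} {Ω : Set E} (hΩ : IsOpen Ω) (h : ∀ p ∈ Ω, F p = 0) (v : E) :
    ∀ p ∈ Ω, pd v F p = 0 := fun p hp => by
  rw [pd_congr (G := fun _ => 0) hΩ h v p hp, pd_const]

lemma pd_comm {F : E → ℝ} {p : E} (h : ContDiffAt ℝ ∞ F p) (v w : E) :
    pd v (pd w F) p = pd w (pd v F) p := by
  have hd : DifferentiableAt ℝ (fderiv ℝ F) p :=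
    (h.fderiv_right (m := ∞) (by simp)).differentiableAt (by simp)
  have key : ∀ a b : E, pd a (pd b F) p = fderiv ℝ (fderiv ℝ F) p a b := fun a b => by
    change fderiv ℝ (fun r => fderiv ℝ F r b) p a = _
    rw [fderiv_clm_apply hd (differentiableAt_const _)]
    simp
  rw [key, key]
  exact (h.isSymmSndFDerivAt (by
    rw [minSmoothness_of_isRCLikeNormedField]; exact WithTop.coe_le_coe.2 (le_top : (2 : ℕ∞) ≤ ⊤))) v w

lemma pd_comp {E' : Type*} [NormedAddCommGroup E'] [NormedSpace ℝ E'] {F : E' → ℝ} {g : E → E'}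
    {p : E} (hF : DifferentiableAt ℝ F (g p)) (hg : DifferentiableAt ℝ g p) (v : E) :
    pd v (fun r => F (g r)) p = pd (fderiv ℝ g p v) F (g p) := by
  have : fderiv ℝ (fun r => F (g r)) p = _ := fderiv_comp p hF hg
  simp [pd, this]

end Calculus

/-! ### Transformation of jets -/

lemma pd_plane (v : Plane) (f : Plane → ℝ) (q : Plane) :
    pd v f q = v.1 * pd (1, 0) f q + v.2 * pd (0, 1) f q := by
  rw [← pd_smul_dir, ← pd_smul_dir, ← pd_add_dir]
  simp

lemma pd_space (a b c : ℝ) (F : Space → ℝ) (p : Space) :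
    pd (a, b, c) F p = a * pd (1, 0, 0) F p + b * pd (0, 1, 0) F p + c * pd (0, 0, 1) F p := by
  rw [← pd_smul_dir, ← pd_smul_dir, ← pd_smul_dir, ← pd_add_dir, ← pd_add_dir]
  simp

lemma pd_comp_pair {h a b : Plane → ℝ} {q : Plane} (hh : DifferentiableAt ℝ h (a q, b q))
    (ha : DifferentiableAt ℝ a q) (hb : DifferentiableAt ℝ b q) (v : Plane) :
    pd v (fun r => h (a r, b r)) q
      = pd (1, 0) h (a q, b q) * pd v a q + pd (0, 1) h (a q, b q) * pd v b q := by
  rw [pd_comp (g := fun r => (a r, b r)) hh (ha.prodMk hb) v,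
    ha.fderiv_prodMk hb, pd_plane]
  simp [pd]
  ring

lemma contDiffAt_graph {E : Type*} [NormedAddCommGroup E] [NormedSpace ℝ E]
    {F : Space → E} {f : Plane → ℝ} {q : Plane}
    (hF : ContDiffAt ℝ ∞ F (q.1, q.2, f q)) (hf : ContDiffAt ℝ ∞ f q) :
    ContDiffAt ℝ ∞ (fun r : Plane => F (r.1, r.2, f r)) q :=
  ContDiffAt.comp q (g := F) (f := fun r : Plane => (r.1, r.2, f r)) hF
    (contDiffAt_fst.prodMk (contDiffAt_snd.prodMk hf))

lemma pd_graph {F : Space → ℝ} {f : Plane → ℝ} {q : Plane}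
    (hF : DifferentiableAt ℝ F (q.1, q.2, f q)) (hf : DifferentiableAt ℝ f q) (v : Plane) :
    pd v (fun r : Plane => F (r.1, r.2, f r)) q
      = pd (v.1, v.2, pd v f q) F (q.1, q.2, f q) := by
  have h2 : DifferentiableAt ℝ (fun r : Plane => (r.2, f r)) q :=
    differentiableAt_snd.prodMk hf
  rw [pd_comp (g := fun r : Plane => (r.1, r.2, f r)) hF
    (differentiableAt_fst.prodMk h2) v, differentiableAt_fst.fderiv_prodMk h2,
    differentiableAt_snd.fderiv_prodMk hf]
  simp [pd, fderiv_fst, fderiv_snd]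

lemma eventually_diffAt {E E' : Type*} [NormedAddCommGroup E] [NormedSpace ℝ E]
    [NormedAddCommGroup E'] [NormedSpace ℝ E'] {F : E → E'} {p : E} (h : ContDiffAt ℝ ∞ F p) :
    ∀ᶠ r in 𝓝 p, DifferentiableAt ℝ F r := by
  filter_upwards [(h.of_le (m := 1) (by exact_mod_cast le_top)).eventually (by simp)] with r hr
  exact hr.differentiableAt (by simp)

/-- The direction tangent to the graph is frozen at its value at `q`; its variation along the graph
is purely in `u`, which produces the term with `F_u`. -/
lemma pd_pd_graph {F : Space → ℝ} {f : Plane → ℝ} {q : Plane}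
    (hF : ContDiffAt ℝ ∞ F (q.1, q.2, f q)) (hf : ContDiffAt ℝ ∞ f q) (v : Plane) :
    pd v (pd v (fun r : Plane => F (r.1, r.2, f r))) q
      = pd (v.1, v.2, pd v f q) (pd (v.1, v.2, pd v f q) F) (q.1, q.2, f q)
        + pd (0, 0, 1) F (q.1, q.2, f q) * pd v (pd v f) q := by
  have hg : ContDiffAt ℝ ∞ (fun r : Plane => (r.1, r.2, f r)) q :=
    contDiffAt_fst.prodMk (contDiffAt_snd.prodMk hf)
  -- `pd` differentiates along a constant vector, while the tangent vector has the variable last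
  -- component `pd v f r`; linearity separates that component as a scalar factor.
  have split : ∀ (c : ℝ) (p : Space), pd (v.1, v.2, c) F p
      = pd (v.1, v.2, 0) F p + c * pd (0, 0, 1) F p := fun c p => by
    rw [pd_space, pd_space v.1 v.2 0]
    ring
  have ev : ∀ᶠ r in 𝓝 q, pd v (fun r : Plane => F (r.1, r.2, f r)) r
      = pd (v.1, v.2, 0) F (r.1, r.2, f r) + pd v f r * pd (0, 0, 1) F (r.1, r.2, f r) := by
    filter_upwards [eventually_diffAt hf,
      hg.continuousAt.eventually (eventually_diffAt hF)] with r h1 h2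
    rw [pd_graph h2 h1, split]
  have h0 := contDiffAt_pd hF (v.1, v.2, 0)
  have h1 := contDiffAt_pd hF (0, 0, 1)
  rw [pd_congr_nhds ev, pd_add (contDiffAt_graph h0 hf)
    ((contDiffAt_pd hf v).mul (contDiffAt_graph h1 hf)),
    pd_mul (contDiffAt_pd hf v) (contDiffAt_graph h1 hf), pd_graph (diffAt h0) (diffAt hf), pd_graph (diffAt h1) (diffAt hf),
    pd_congr_nhds (F := pd (v.1, v.2, pd v f q) F) (Eventually.of_forall (split _)),
    pd_add h0 (contDiffAt_const.mul h1), pd_const_mul h1]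
  ring

/-- The assumptions on `v` say that it is mapped to the second coordinate direction at `q`, so
`h_x̃x̃` is the only second derivative of `h` to survive. It can then be solved for. -/
lemma pd_pd_comp_pair {h a b : Plane → ℝ} {q : Plane} (hh : ContDiffAt ℝ ∞ h (a q, b q))
    (ha : ContDiffAt ℝ ∞ a q) (hb : ContDiffAt ℝ ∞ b q) (v : Plane)
    (hva : pd v a q = 0) (hvb : pd v b q = 1) :
    pd v (pd v (fun r => h (a r, b r))) q
      = pd (1, 0) h (a q, b q) * pd v (pd v a) q + pd (0, 1) h (a q, b q) * pd v (pd v b) q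
        + pd (0, 1) (pd (0, 1) h) (a q, b q) := by
  have hg : ContDiffAt ℝ ∞ (fun r => (a r, b r)) q := ha.prodMk hb
  have ev : ∀ᶠ r in 𝓝 q, pd v (fun r => h (a r, b r)) r
      = pd (1, 0) h (a r, b r) * pd v a r + pd (0, 1) h (a r, b r) * pd v b r := by
    filter_upwards [eventually_diffAt ha, eventually_diffAt hb,
      hg.continuousAt.eventually (eventually_diffAt hh)] with r h1 h2 h3
    rw [pd_comp_pair h3 h1 h2]
  have h1 := contDiffAt_pd hh (1, 0)
  have h2 := contDiffAt_pd hh (0, 1)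
  have c1 : ContDiffAt ℝ ∞ (fun r => pd (1, 0) h (a r, b r)) q := 
    ContDiffAt.comp q (g := pd (1, 0) h) (f := fun r => (a r, b r)) h1 hg
  have c2 : ContDiffAt ℝ ∞ (fun r => pd (0, 1) h (a r, b r)) q := 
    ContDiffAt.comp q (g := pd (0, 1) h) (f := fun r => (a r, b r)) h2 hg
  rw [pd_congr_nhds ev, pd_add (c1.mul (contDiffAt_pd ha v)) (c2.mul (contDiffAt_pd hb v)),
    pd_mul c1 (contDiffAt_pd ha v), pd_mul c2 (contDiffAt_pd hb v), pd_comp_pair (diffAt h1) (diffAt ha) (diffAt hb),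
    pd_comp_pair (diffAt h2) (diffAt ha) (diffAt hb), hva, hvb]
  ring

/-- Near a point where `(a, b)` has nonzero Jacobian, `w` is a smooth function of `(a, b)`. -/
lemma exists_eq_comp_pair {a b w : Plane → ℝ} {q : Plane} (ha : ContDiffAt ℝ ∞ a q)
    (hb : ContDiffAt ℝ ∞ b q) (hw : ContDiffAt ℝ ∞ w q)
    (hD : pd (1, 0) a q * pd (0, 1) b q - pd (0, 1) a q * pd (1, 0) b q ≠ 0) :
    ∃ h : Plane → ℝ, ContDiffAt ℝ ∞ h (a q, b q) ∧ ∀ᶠ r in 𝓝 q, h (a r, b r) = w r := by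
  have hg : ContDiffAt ℝ ∞ (fun r => (a r, b r)) q := ha.prodMk hb
  have hfd : fderiv ℝ (fun r => (a r, b r)) q = (fderiv ℝ a q).prod (fderiv ℝ b q) :=
    (diffAt ha).fderiv_prodMk (diffAt hb)
  have hinj : Function.Injective ((fderiv ℝ (fun r => (a r, b r)) q : Plane →ₗ[ℝ] Plane)) := by
    refine (injective_iff_map_eq_zero _).2 fun v hv => ?_
    rw [hfd] at hv
    have h1 : pd v a q = 0 := congrArg Prod.fst hv
    have h2 : pd v b q = 0 := congrArg Prod.snd hv
    rw [pd_plane] at h1 h2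
    ext
    -- Cramer's rule: the Jacobian annihilates both components of a kernel vector.
    · refine (mul_eq_zero.1 (?_ : v.1 * _ = 0)).resolve_right hD
      linear_combination pd (0, 1) b q * h1 - pd (0, 1) a q * h2
    · refine (mul_eq_zero.1 (?_ : v.2 * _ = 0)).resolve_right hD
      linear_combination pd (1, 0) a q * h2 - pd (1, 0) b q * h1
  let e : Plane ≃L[ℝ] Plane := (LinearEquiv.ofInjectiveEndo _ hinj).toContinuousLinearEquiv
  have he : HasFDerivAt (fun r => (a r, b r)) (e : Plane →L[ℝ] Plane) q := by
    have : (e : Plane →L[ℝ] Plane) = fderiv ℝ (fun r => (a r, b r)) q := by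
      ext <;> rfl
    rw [this]
    exact (hg.differentiableAt (by simp)).hasFDerivAt
  have hn : (∞ : WithTop ℕ∞) ≠ 0 := by simp
  have hinv : hg.localInverse he hn (a q, b q) = q :=
    (hg.hasStrictFDerivAt' he hn).localInverse_apply_image
  refine ⟨fun z => w (hg.localInverse he hn z), ?_, ?_⟩
  · exact ContDiffAt.comp (a q, b q) (hinv.symm ▸ hw) (hg.to_localInverse he hn)
  · filter_upwards [(hg.hasStrictFDerivAt' he hn).eventually_left_inverse] with r hr
    exact congrArg w hr

/-! ### The polynomial with a prescribed jet -/

/-- A quadratic polynomial with prescribed value `u`, first derivatives `α`, `β`, and pure second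
derivatives `ε`, `γ` at `(t, x)`. -/
noncomputable def jetPoly (t x u α β γ ε : ℝ) (r : Plane) : ℝ :=
  u + α * (r.1 - t) + β * (r.2 - x) + γ / 2 * (r.2 - x) ^ 2 + ε / 2 * (r.1 - t) ^ 2

lemma contDiff_jetPoly (t x u α β γ ε : ℝ) : ContDiff ℝ ∞ (jetPoly t x u α β γ ε) := by
  unfold jetPoly
  fun_prop

lemma pd_snd (v r : Plane) : pd v Prod.snd r = v.2 := by simp [pd, fderiv_snd]

lemma pd_jetPoly (t x u α β γ ε : ℝ) (v r : Plane) :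
    pd v (jetPoly t x u α β γ ε) r
      = v.1 * (α + ε * (r.1 - t)) + v.2 * (β + γ * (r.2 - x)) := by
  have h1 : HasFDerivAt (fun r : Plane => r.1 - t) (ContinuousLinearMap.fst ℝ ℝ ℝ) r :=
    hasFDerivAt_fst.sub_const t
  have h2 : HasFDerivAt (fun r : Plane => r.2 - x) (ContinuousLinearMap.snd ℝ ℝ ℝ) r :=
    hasFDerivAt_snd.sub_const x
  have h := ((((h1.const_mul α).const_add u).add (h2.const_mul β)).add
    ((h2.pow 2).const_mul (γ / 2))).add ((h1.pow 2).const_mul (ε / 2))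
  have h' : HasFDerivAt (jetPoly t x u α β γ ε) _ r := h
  rw [pd, h'.fderiv]
  simp
  ring

lemma pd_pd_jetPoly (t x u α β γ ε : ℝ) (v r : Plane) :
    pd v (pd v (jetPoly t x u α β γ ε)) r = γ * v.2 ^ 2 + ε * v.1 ^ 2 := by
  have : pd v (jetPoly t x u α β γ ε)
      = jetPoly t x (v.1 * α + v.2 * β) (v.1 * ε) (v.2 * γ) 0 0 := by
    ext r
    rw [pd_jetPoly, jetPoly]
    ring
  rw [this, pd_jetPoly]
  ring

/-! ### Point transformations of equations in terms of jets -/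

/-- The components of a map into the space of `(t, x, u)`. -/
def cT (φ : Space → Space) (p : Space) : ℝ := (φ p).1

/-- See `cT`. -/
def cX (φ : Space → Space) (p : Space) : ℝ := (φ p).2.1

/-- See `cT`. -/
def cU (φ : Space → Space) (p : Space) : ℝ := (φ p).2.2

/-- The condition of mapping one equation to another, at the jet with value `u`, first derivatives
`α`, `β`, second derivatives `γ = f_xx`, `ε = f_tt` and `f_tx = 0`. Here `(v₁, v₂)` is the direction
on the graph that is mapped to the `x̃`-direction, and `m`, `n` are the first derivatives of the
transformed function. -/
lemma MapsEquation.jet {Ω : Set Space} {φ : Space → Space} {θ θ' : Coeffs}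
    (h : MapsEquation Ω φ θ θ') {t x u : ℝ} (hp : (t, x, u) ∈ Ω)
    (hφ : ContDiffAt ℝ ∞ φ (t, x, u)) (α β γ ε v₁ v₂ m n : ℝ)
    (hD : pd (1, 0, α) (cT φ) (t, x, u) * pd (0, 1, β) (cX φ) (t, x, u)
      - pd (0, 1, β) (cT φ) (t, x, u) * pd (1, 0, α) (cX φ) (t, x, u) ≠ 0)
    (hvT : pd (v₁, v₂, v₁ * α + v₂ * β) (cT φ) (t, x, u) = 0)
    (hvX : pd (v₁, v₂, v₁ * α + v₂ * β) (cX φ) (t, x, u) = 1)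
    (ht : m * pd (1, 0, α) (cT φ) (t, x, u) + n * pd (1, 0, α) (cX φ) (t, x, u)
      = pd (1, 0, α) (cU φ) (t, x, u))
    (hx : m * pd (0, 1, β) (cT φ) (t, x, u) + n * pd (0, 1, β) (cX φ) (t, x, u)
      = pd (0, 1, β) (cU φ) (t, x, u)) :
    α + u * β - θ.A2 (t, x) * γ - θ.A1 (t, x) * β = 0 ↔
      m + cU φ (t, x, u) * n - θ'.A2 (base (φ (t, x, u))) *
        (pd (v₁, v₂, v₁ * α + v₂ * β) (pd (v₁, v₂, v₁ * α + v₂ * β) (cU φ)) (t, x, u)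
          - m * pd (v₁, v₂, v₁ * α + v₂ * β) (pd (v₁, v₂, v₁ * α + v₂ * β) (cT φ)) (t, x, u)
          - n * pd (v₁, v₂, v₁ * α + v₂ * β) (pd (v₁, v₂, v₁ * α + v₂ * β) (cX φ)) (t, x, u)
          + (pd (0, 0, 1) (cU φ) (t, x, u) - m * pd (0, 0, 1) (cT φ) (t, x, u)
            - n * pd (0, 0, 1) (cX φ) (t, x, u)) * (γ * v₂ ^ 2 + ε * v₁ ^ 2))
        - θ'.A1 (base (φ (t, x, u))) * n = 0 := by
  set f := jetPoly t x u α β γ ε with hf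
  have f0 : f (t, x) = u := by simp [hf, jetPoly]
  have fs : ContDiffAt ℝ ∞ f (t, x) := (contDiff_jetPoly ..).contDiffAt
  have f1 : ∀ v : Plane, pd v f (t, x) = v.1 * α + v.2 * β := fun v => by
    rw [hf, pd_jetPoly]
    simp
  have hT : ContDiffAt ℝ ∞ (cT φ) ((t, x).1, (t, x).2, f (t, x)) := by
    rw [f0]; exact contDiffAt_fst.comp (t, x, u) hφ
  have hX : ContDiffAt ℝ ∞ (cX φ) ((t, x).1, (t, x).2, f (t, x)) := by
    rw [f0]; exact contDiffAt_fst.comp (t, x, u) (contDiffAt_snd.comp (t, x, u) hφ)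
  have hU : ContDiffAt ℝ ∞ (cU φ) ((t, x).1, (t, x).2, f (t, x)) := by
    rw [f0]; exact contDiffAt_snd.comp (t, x, u) (contDiffAt_snd.comp (t, x, u) hφ)
  set a : Plane → ℝ := fun r => cT φ (r.1, r.2, f r) with ha
  set b : Plane → ℝ := fun r => cX φ (r.1, r.2, f r) with hb
  set w : Plane → ℝ := fun r => cU φ (r.1, r.2, f r) with hw
  have sa : ContDiffAt ℝ ∞ a (t, x) := contDiffAt_graph hT fs
  have sb : ContDiffAt ℝ ∞ b (t, x) := contDiffAt_graph hX fs
  have sw : ContDiffAt ℝ ∞ w (t, x) := contDiffAt_graph hU fs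
  have da : ∀ v : Plane, pd v a (t, x) = pd (v.1, v.2, v.1 * α + v.2 * β) (cT φ) (t, x, u) :=
    fun v => by rw [ha, pd_graph (diffAt hT) (diffAt fs), f1, f0]
  have db : ∀ v : Plane, pd v b (t, x) = pd (v.1, v.2, v.1 * α + v.2 * β) (cX φ) (t, x, u) :=
    fun v => by rw [hb, pd_graph (diffAt hX) (diffAt fs), f1, f0]
  have dw : ∀ v : Plane, pd v w (t, x) = pd (v.1, v.2, v.1 * α + v.2 * β) (cU φ) (t, x, u) :=
    fun v => by rw [hw, pd_graph (diffAt hU) (diffAt fs), f1, f0]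
  have hD' : pd (1, 0) a (t, x) * pd (0, 1) b (t, x)
      - pd (0, 1) a (t, x) * pd (1, 0) b (t, x) ≠ 0 := by
    simpa [da, db] using hD
  -- `MapsEquation` speaks of a given transformed function; the inverse function theorem supplies
  -- one.
  obtain ⟨f', sf', ef'⟩ := exists_eq_comp_pair sa sb sw hD'
  have key := h (t, x) f f' fs (by simpa [f0] using hp) hD'
    (by exact sf') (by exact ef')
  have ew : ∀ v : Plane, pd v (fun r => f' (a r, b r)) (t, x) = pd v w (t, x) :=
    fun v => pd_congr_nhds ef' v
  have ew2 : ∀ v : Plane, pd v (pd v (fun r => f' (a r, b r))) (t, x) = pd v (pd v w) (t, x) := by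
    intro v
    refine pd_congr_nhds ?_ v
    filter_upwards [ef'.eventually_nhds] with r hr
    exact pd_congr_nhds hr v
  have et := ew (1, 0)
  have ex := ew (0, 1)
  rw [pd_comp_pair (diffAt sf') (diffAt sa) (diffAt sb), da, db, dw] at et ex
  simp only [one_mul, zero_mul, add_zero, zero_add] at et ex
  -- `(m, n)` and the gradient of `f'` solve the same linear system, whose determinant is the
  -- Jacobian in `hD`.
  have em : pd (1, 0) f' (a (t, x), b (t, x)) = m := by
    refine mul_right_cancel₀ hD ?_
    linear_combination pd (0, 1, β) (cX φ) (t, x, u) * (et - ht)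
      - pd (1, 0, α) (cX φ) (t, x, u) * (ex - hx)
  have en : pd (0, 1) f' (a (t, x), b (t, x)) = n := by
    refine mul_right_cancel₀ hD ?_
    linear_combination pd (1, 0, α) (cT φ) (t, x, u) * (ex - hx)
      - pd (0, 1, β) (cT φ) (t, x, u) * (et - ht)
  have e2 := ew2 (v₁, v₂)
  rw [pd_pd_comp_pair sf' sa sb _ (by rw [da]; exact hvT) (by rw [db]; exact hvX), em, en,
    ha, hb, hw, pd_pd_graph hT fs, pd_pd_graph hX fs, pd_pd_graph hU fs, f1, f0,
    pd_pd_jetPoly] at e2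
  have r1 : residual θ f (t, x) = α + u * β - θ.A2 (t, x) * γ - θ.A1 (t, x) * β := by
    rw [residual, dt_eq_pd, dx_eq_pd, dx_eq_pd, f1, f1, f0, hf, pd_pd_jetPoly]
    simp
  have eb : base (φ ((t, x).1, (t, x).2, f (t, x))) = (a (t, x), b (t, x)) := rfl
  have e0 : f' (a (t, x), b (t, x)) = cU φ (t, x, u) := by
    rw [ef'.self_of_nhds, hw]
    simp only [f0]
  have eb' : base (φ (t, x, u)) = (a (t, x), b (t, x)) := by rw [← eb, f0]
  rw [r1] at key
  refine key.trans ?_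
  simp only [eb, eb']
  rw [residual, dt_eq_pd, dx_eq_pd, dx_eq_pd, em, en, e0]
  have e3 : pd (0, 1) (pd (0, 1) f') (a (t, x), b (t, x)) = _ := eq_sub_of_add_eq' e2
  rw [e3]
  refine Eq.congr ?_ rfl
  simp only
  ring

local notation "∂₁" => pd ((1, 0, 0) : Space)
local notation "∂₂" => pd ((0, 1, 0) : Space)
local notation "∂₃" => pd ((0, 0, 1) : Space)

/-! ### Nondegeneracy of point transformations -/

/-- Differentiating `φ ∘ g = id` shows that the differential of `φ` is onto. Nondegeneracy is used
only in this form, which avoids three-by-three determinants. -/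
lemma IsDiffeo.exists_pd_eq {Ω Ω' : Set Space} {φ : Space → Space} (hΩ : IsOpen Ω)
    (hΩ' : IsOpen Ω') (h : IsDiffeo φ Ω Ω') {p : Space} (hp : p ∈ Ω) (z : Space) :
    ∃ V : Space, pd V (cT φ) p = z.1 ∧ pd V (cX φ) p = z.2.1 ∧ pd V (cU φ) p = z.2.2 := by
  obtain ⟨hs, hm, g, gs, gm, hi⟩ := h
  have dφ : DifferentiableAt ℝ φ p :=
    (hs.contDiffAt (hΩ.mem_nhds hp)).differentiableAt (by simp)
  have dg : DifferentiableAt ℝ g (φ p) :=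
    (gs.contDiffAt (hΩ'.mem_nhds (hm hp))).differentiableAt (by simp)
  have hgp : g (φ p) = p := hi.1 hp
  have hid : (fun r => φ (g r)) =ᶠ[𝓝 (φ p)] id := by
    filter_upwards [hΩ'.mem_nhds (hm hp)] with r hr
    exact hi.2 hr
  have hc : fderiv ℝ (fun r => φ (g r)) (φ p) = (fderiv ℝ φ p).comp (fderiv ℝ g (φ p)) := by
    have := fderiv_comp (φ p) (g := φ) (f := g) (by rw [hgp]; exact dφ) dg
    rwa [hgp] at this
  rw [hid.fderiv_eq, fderiv_id] at hc
  have hz : fderiv ℝ φ p (fderiv ℝ g (φ p) z) = z := (DFunLike.congr_fun hc z).symm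
  have e1 : fderiv ℝ (cT φ) p = (ContinuousLinearMap.fst ℝ ℝ (ℝ × ℝ)).comp (fderiv ℝ φ p) :=
    (hasFDerivAt_fst.comp p dφ.hasFDerivAt).fderiv
  have e2 : fderiv ℝ (cX φ) p = ((ContinuousLinearMap.fst ℝ ℝ ℝ).comp
      (ContinuousLinearMap.snd ℝ ℝ (ℝ × ℝ))).comp (fderiv ℝ φ p) :=
    ((((ContinuousLinearMap.fst ℝ ℝ ℝ).comp
      (ContinuousLinearMap.snd ℝ ℝ (ℝ × ℝ))).hasFDerivAt).comp p dφ.hasFDerivAt).fderiv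
  have e3 : fderiv ℝ (cU φ) p = ((ContinuousLinearMap.snd ℝ ℝ ℝ).comp
      (ContinuousLinearMap.snd ℝ ℝ (ℝ × ℝ))).comp (fderiv ℝ φ p) :=
    ((((ContinuousLinearMap.snd ℝ ℝ ℝ).comp
      (ContinuousLinearMap.snd ℝ ℝ (ℝ × ℝ))).hasFDerivAt).comp p dφ.hasFDerivAt).fderiv
  refine ⟨fderiv ℝ g (φ p) z, ?_, ?_, ?_⟩
  · simp only [pd, e1, ContinuousLinearMap.comp_apply, hz]; rfl
  · simp only [pd, e2, ContinuousLinearMap.comp_apply, hz]; rfl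
  · simp only [pd, e3, ContinuousLinearMap.comp_apply, hz]; rfl

/-- A product of two nonzero affine polynomials is a nonzero polynomial; five sample points recover
enough of its coefficients. The factors will be the Jacobian on a graph and the total `x`-derivative
of `T`, as functions of the first-order jet `(α, β)`. -/
lemma exists_affine_ne_zero {c₀ c₁ c₂ d₀ d₁ : ℝ} (hc : ¬ (c₀ = 0 ∧ c₁ = 0 ∧ c₂ = 0))
    (hd : ¬ (d₀ = 0 ∧ d₁ = 0)) :
    ∃ α β : ℝ, c₀ + α * c₁ + β * c₂ ≠ 0 ∧ d₀ + β * d₁ ≠ 0 := by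
  by_contra hcon
  have h : ∀ α β : ℝ, (c₀ + α * c₁ + β * c₂) * (d₀ + β * d₁) = 0 := fun α β => by
    by_contra hne
    exact hcon ⟨α, β, left_ne_zero_of_mul hne, right_ne_zero_of_mul hne⟩
  have h00 := h 0 0
  have h10 := h 1 0
  have h01 := h 0 1
  have h11 := h 1 1
  have h0m := h 0 (-1)
  have a1 : c₁ * d₀ = 0 := by linear_combination h10 - h00
  have a2 : c₁ * d₁ = 0 := by linear_combination h11 - h01 - a1
  have a3 : c₀ * d₀ = 0 := by linear_combination h00
  have a4 : c₂ * d₁ = 0 := by linear_combination (h01 + h0m) / 2 - a3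
  have a5 : c₀ * d₁ + c₂ * d₀ = 0 := by linear_combination (h01 - h0m) / 2
  rcases not_and_or.1 hd with h0 | h1
  · have b1 := (mul_eq_zero.1 a1).resolve_right h0
    have b3 := (mul_eq_zero.1 a3).resolve_right h0
    rw [b3, zero_mul, zero_add] at a5
    exact hc ⟨b3, b1, (mul_eq_zero.1 a5).resolve_right h0⟩
  · have b1 := (mul_eq_zero.1 a2).resolve_right h1
    have b3 := (mul_eq_zero.1 a4).resolve_right h1
    rw [b3, zero_mul, add_zero] at a5
    exact hc ⟨(mul_eq_zero.1 a5).resolve_right h1, b1, b3⟩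

/-- A point transformation between two equations of the class maps `t` to a function of `t`. -/
lemma MapsEquation.cT_indep {Ω : Set Space} {φ : Space → Space} {θ θ' : Coeffs}
    (h : MapsEquation Ω φ θ θ') {p : Space} (hp : p ∈ Ω) (hφ : ContDiffAt ℝ ∞ φ p)
    (hV : ∀ z : Space, ∃ V : Space,
      pd V (cT φ) p = z.1 ∧ pd V (cX φ) p = z.2.1 ∧ pd V (cU φ) p = z.2.2)
    (hA : θ.A2 (base p) ≠ 0) (hA' : θ'.A2 (base (φ p)) ≠ 0) :
    ∂₂ (cT φ) p = 0 ∧ ∂₃ (cT φ) p = 0 := by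
  obtain ⟨t, x, u⟩ := p
  by_contra hne
  -- These are the two-by-two minors of the gradients of `T` and `X`. If all vanished, the pair `(T,
  -- X)` could not have both `(1, 0)` and `(0, 1)` among its directional derivatives.
  have hc : ¬ (∂₁ (cT φ) (t, x, u) * ∂₂ (cX φ) (t, x, u)
        - ∂₂ (cT φ) (t, x, u) * ∂₁ (cX φ) (t, x, u) = 0 ∧
      ∂₃ (cT φ) (t, x, u) * ∂₂ (cX φ) (t, x, u)
        - ∂₂ (cT φ) (t, x, u) * ∂₃ (cX φ) (t, x, u) = 0 ∧
      ∂₁ (cT φ) (t, x, u) * ∂₃ (cX φ) (t, x, u)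
        - ∂₃ (cT φ) (t, x, u) * ∂₁ (cX φ) (t, x, u) = 0) := by
    rintro ⟨c0, c1, c2⟩
    obtain ⟨⟨a₁, a₂, a₃⟩, hT, hX, -⟩ := hV (1, 0, 0)
    obtain ⟨⟨b₁, b₂, b₃⟩, kT, kX, -⟩ := hV (0, 1, 0)
    rw [pd_space] at hT hX kT kX
    simp only at hT hX kT kX
    set T₁ := ∂₁ (cT φ) (t, x, u)
    set T₂ := ∂₂ (cT φ) (t, x, u)
    set T₃ := ∂₃ (cT φ) (t, x, u)
    set X₁ := ∂₁ (cX φ) (t, x, u)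
    set X₂ := ∂₂ (cX φ) (t, x, u)
    set X₃ := ∂₃ (cX φ) (t, x, u)
    have e : (a₁ * T₁ + a₂ * T₂ + a₃ * T₃) * (b₁ * X₁ + b₂ * X₂ + b₃ * X₃)
        - (b₁ * T₁ + b₂ * T₂ + b₃ * T₃) * (a₁ * X₁ + a₂ * X₂ + a₃ * X₃) = 0 := by
      linear_combination (a₁ * b₂ - a₂ * b₁) * c0 + (a₃ * b₂ - a₂ * b₃) * c1
        + (a₁ * b₃ - a₃ * b₁) * c2
    rw [hT, hX, kT, kX] at e
    norm_num at e
  obtain ⟨α, β, hD, hax⟩ := exists_affine_ne_zero hc hne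
  obtain ⟨V, kT, kX, kU⟩ := hV (0, 0, 1)
  obtain ⟨V₁, V₂, V₃⟩ := V
  have at_eq : ∀ F : Space → ℝ, pd (1, 0, α) F (t, x, u) = ∂₁ F (t, x, u) + α * ∂₃ F (t, x, u) :=
    fun F => by rw [pd_space]; ring
  have ax_eq : ∀ F : Space → ℝ, pd (0, 1, β) F (t, x, u) = ∂₂ F (t, x, u) + β * ∂₃ F (t, x, u) :=
    fun F => by rw [pd_space]; ring
  rw [pd_space] at kT kX kU
  simp only at kT kX kU
  have D_eq : pd (1, 0, α) (cT φ) (t, x, u) * pd (0, 1, β) (cX φ) (t, x, u)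
      - pd (0, 1, β) (cT φ) (t, x, u) * pd (1, 0, α) (cX φ) (t, x, u) ≠ 0 := by
    rw [at_eq, at_eq, ax_eq, ax_eq]
    convert hD using 1
    ring
  rw [← ax_eq] at hax
  set D := pd (1, 0, α) (cT φ) (t, x, u) * pd (0, 1, β) (cX φ) (t, x, u)
      - pd (0, 1, β) (cT φ) (t, x, u) * pd (1, 0, α) (cX φ) (t, x, u) with hDdef
  have hv : ∀ (v₁ v₂ : ℝ) (F : Space → ℝ), pd (v₁, v₂, v₁ * α + v₂ * β) F (t, x, u)
      = v₁ * pd (1, 0, α) F (t, x, u) + v₂ * pd (0, 1, β) F (t, x, u) := fun v₁ v₂ F => by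
    rw [at_eq, ax_eq, pd_space]; ring
  have key := fun (γ ε : ℝ) => h.jet hp hφ α β γ ε (-pd (0, 1, β) (cT φ) (t, x, u) / D)
    (pd (1, 0, α) (cT φ) (t, x, u) / D)
    ((pd (1, 0, α) (cU φ) (t, x, u) * pd (0, 1, β) (cX φ) (t, x, u)
      - pd (0, 1, β) (cU φ) (t, x, u) * pd (1, 0, α) (cX φ) (t, x, u)) / D)
    ((pd (1, 0, α) (cT φ) (t, x, u) * pd (0, 1, β) (cU φ) (t, x, u)
      - pd (0, 1, β) (cT φ) (t, x, u) * pd (1, 0, α) (cU φ) (t, x, u)) / D)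
    D_eq (by rw [hv]; ring)
    (by rw [hv]; field_simp; rw [hDdef]; ring)
    (by field_simp; rw [hDdef]; ring) (by field_simp; rw [hDdef]; ring)
  set m := (pd (1, 0, α) (cU φ) (t, x, u) * pd (0, 1, β) (cX φ) (t, x, u)
      - pd (0, 1, β) (cU φ) (t, x, u) * pd (1, 0, α) (cX φ) (t, x, u)) / D with hm
  set n := (pd (1, 0, α) (cT φ) (t, x, u) * pd (0, 1, β) (cU φ) (t, x, u)
      - pd (0, 1, β) (cT φ) (t, x, u) * pd (1, 0, α) (cU φ) (t, x, u)) / D with hn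
  have mn1 : m * pd (1, 0, α) (cT φ) (t, x, u) + n * pd (1, 0, α) (cX φ) (t, x, u)
      = pd (1, 0, α) (cU φ) (t, x, u) := by
    rw [hm, hn]; field_simp; rw [hDdef]; ring
  have mn2 : m * pd (0, 1, β) (cT φ) (t, x, u) + n * pd (0, 1, β) (cX φ) (t, x, u)
      = pd (0, 1, β) (cU φ) (t, x, u) := by
    rw [hm, hn]; field_simp; rw [hDdef]; ring
  -- The differential of `U - m T - n X` kills both tangent vectors of the graph. If it also killed
  -- the `u`-direction it would be zero, yet it equals `1` on the vector that `φ` maps to `(0, 0,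
  -- 1)`.
  have hκ : ∂₃ (cU φ) (t, x, u) - m * ∂₃ (cT φ) (t, x, u) - n * ∂₃ (cX φ) (t, x, u) ≠ 0 := by
    intro h0
    rw [at_eq, at_eq, at_eq] at mn1
    rw [ax_eq, ax_eq, ax_eq] at mn2
    have : (0 : ℝ) = 1 := by
      linear_combination kU - m * kT - n * kX + V₁ * (mn1 + α * h0) + V₂ * (mn2 + β * h0) - V₃ * h0
    norm_num at this
  simp only [base] at hA
  have hsol : α + u * β - θ.A2 (t, x) * ((α + u * β - θ.A1 (t, x) * β) / θ.A2 (t, x))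
      - θ.A1 (t, x) * β = 0 := by
    field_simp; ring
  -- The source equation fixes `γ` and ignores `ε = f_tt`. Comparing `ε = 0` with `ε = 1` isolates
  -- the coefficient of `f_tt` in the target equation.
  have k0 := (key ((α + u * β - θ.A1 (t, x) * β) / θ.A2 (t, x)) 0).1 hsol
  have k1 := (key ((α + u * β - θ.A1 (t, x) * β) / θ.A2 (t, x)) 1).1 hsol
  have hz : θ'.A2 (base (φ (t, x, u))) * ((∂₃ (cU φ) (t, x, u) - m * ∂₃ (cT φ) (t, x, u)
      - n * ∂₃ (cX φ) (t, x, u)) * (-pd (0, 1, β) (cT φ) (t, x, u) / D) ^ 2) = 0 := by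
    linear_combination k0 - k1
  exact mul_ne_zero hA' (mul_ne_zero hκ
    (pow_ne_zero 2 (div_ne_zero (neg_ne_zero.2 hax) D_eq))) hz

lemma pd_pd_vert {F : Space → ℝ} {p : Space} (hF : ContDiffAt ℝ ∞ F p) (c β : ℝ) :
    pd (0, c, c * β) (pd (0, c, c * β) F) p
      = c ^ 2 * (∂₂ (∂₂ F) p + 2 * β * ∂₂ (∂₃ F) p + β ^ 2 * ∂₃ (∂₃ F) p) := by
  have split : ∀ r : Space, pd (0, c, c * β) F r = c * ∂₂ F r + (c * β) * ∂₃ F r := fun r => by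
    rw [pd_space]; ring
  have h2 := contDiffAt_pd hF (0, 1, 0)
  have h3 := contDiffAt_pd hF (0, 0, 1)
  rw [pd_congr_nhds (Eventually.of_forall split),
    pd_add (contDiffAt_const.mul h2) (contDiffAt_const.mul h3), pd_const_mul h2, pd_const_mul h3,
    pd_space, pd_space (F := ∂₃ F), pd_comm hF (0, 0, 1) (0, 1, 0)]
  ring

/-- A point transformation of the form `t̃ = T(t)`, `x̃ = X(t, x, u)`, `ũ = U(t, x, u)`
has `T_t ≠ 0` and `X_x U_u - X_u U_x ≠ 0`. -/
lemma nondegenerate_of_cT_indep {φ : Space → Space} {p : Space}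
    (hV : ∀ z : Space, ∃ V : Space,
      pd V (cT φ) p = z.1 ∧ pd V (cX φ) p = z.2.1 ∧ pd V (cU φ) p = z.2.2)
    (h2 : ∂₂ (cT φ) p = 0) (h3 : ∂₃ (cT φ) p = 0) :
    ∂₁ (cT φ) p ≠ 0 ∧
      ∂₂ (cX φ) p * ∂₃ (cU φ) p - ∂₃ (cX φ) p * ∂₂ (cU φ) p ≠ 0 := by
  obtain ⟨⟨a₁, a₂, a₃⟩, aT, -, -⟩ := hV (1, 0, 0)
  obtain ⟨⟨b₁, b₂, b₃⟩, bT, bX, bU⟩ := hV (0, 1, 0)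
  obtain ⟨⟨c₁, c₂, c₃⟩, cT', cX', cU'⟩ := hV (0, 0, 1)
  rw [pd_space, h2, h3] at aT bT cT'
  rw [pd_space] at bX bU cX' cU'
  simp only at aT bT bX bU cT' cX' cU'
  have hT : ∂₁ (cT φ) p ≠ 0 := by
    intro h0
    rw [h0] at aT
    norm_num at aT
  refine ⟨hT, fun hδ => ?_⟩
  have b0 : b₁ = 0 := by
    refine (mul_eq_zero.1 (?_ : b₁ * _ = 0)).resolve_right hT
    linear_combination bT
  have c0 : c₁ = 0 := by
    refine (mul_eq_zero.1 (?_ : c₁ * _ = 0)).resolve_right hT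
    linear_combination cT'
  subst b0 c0
  -- The preimages of the `x̃`- and `ũ`-directions have no `t`-component, so the determinant of
  -- their `(X, U)`-images, which is `1`, is a multiple of the minor assumed to vanish.
  have e : (0 * ∂₁ (cX φ) p + b₂ * ∂₂ (cX φ) p + b₃ * ∂₃ (cX φ) p)
      * (0 * ∂₁ (cU φ) p + c₂ * ∂₂ (cU φ) p + c₃ * ∂₃ (cU φ) p)
      - (0 * ∂₁ (cX φ) p + c₂ * ∂₂ (cX φ) p + c₃ * ∂₃ (cX φ) p)
      * (0 * ∂₁ (cU φ) p + b₂ * ∂₂ (cU φ) p + b₃ * ∂₃ (cU φ) p) = 0 := by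
    linear_combination (b₂ * c₃ - b₃ * c₂) * hδ
  rw [bX, cU', cX', bU] at e
  norm_num at e

/-- The condition of mapping one equation to another when `t̃ = T(t)`. -/
lemma MapsEquation.jet_vert {Ω : Set Space} {φ : Space → Space} {θ θ' : Coeffs}
    (h : MapsEquation Ω φ θ θ') (hΩ : IsOpen Ω) {t x u : ℝ} (hp : (t, x, u) ∈ Ω)
    (hφ : ContDiffAt ℝ ∞ φ (t, x, u))
    (h2 : ∀ p ∈ Ω, ∂₂ (cT φ) p = 0) (h3 : ∀ p ∈ Ω, ∂₃ (cT φ) p = 0)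
    (h1 : ∂₁ (cT φ) (t, x, u) ≠ 0) (α β γ n b : ℝ)
    (hb : ∂₂ (cX φ) (t, x, u) + β * ∂₃ (cX φ) (t, x, u) = b) (hb0 : b ≠ 0)
    (hn : n * b = ∂₂ (cU φ) (t, x, u) + β * ∂₃ (cU φ) (t, x, u))
    (hs : α + u * β - θ.A2 (t, x) * γ - θ.A1 (t, x) * β = 0) :
    (∂₁ (cU φ) (t, x, u) + α * ∂₃ (cU φ) (t, x, u)
        - n * (∂₁ (cX φ) (t, x, u) + α * ∂₃ (cX φ) (t, x, u))) / ∂₁ (cT φ) (t, x, u)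
      + cU φ (t, x, u) * n
      - θ'.A2 (base (φ (t, x, u))) / b ^ 2 *
        (∂₂ (∂₂ (cU φ)) (t, x, u) + 2 * β * ∂₂ (∂₃ (cU φ)) (t, x, u)
          + β ^ 2 * ∂₃ (∂₃ (cU φ)) (t, x, u)
          - n * (∂₂ (∂₂ (cX φ)) (t, x, u) + 2 * β * ∂₂ (∂₃ (cX φ)) (t, x, u)
          + β ^ 2 * ∂₃ (∂₃ (cX φ)) (t, x, u))
          + (∂₃ (cU φ) (t, x, u) - n * ∂₃ (cX φ) (t, x, u)) * γ)
      - θ'.A1 (base (φ (t, x, u))) * n = 0 := by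
  have at_eq : ∀ F : Space → ℝ, pd (1, 0, α) F (t, x, u) = ∂₁ F (t, x, u) + α * ∂₃ F (t, x, u) :=
    fun F => by rw [pd_space]; ring
  have ax_eq : ∀ F : Space → ℝ, pd (0, 1, β) F (t, x, u) = ∂₂ F (t, x, u) + β * ∂₃ F (t, x, u) :=
    fun F => by rw [pd_space]; ring
  have hT2 := h2 _ hp
  have hT3 := h3 _ hp
  have hTv : ∀ p ∈ Ω, pd (0, b⁻¹, b⁻¹ * β) (cT φ) p = 0 := fun p hp => by
    rw [pd_space, h2 p hp, h3 p hp]; ring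
  have hX : ContDiffAt ℝ ∞ (cX φ) (t, x, u) :=
    contDiffAt_fst.comp (t, x, u) (contDiffAt_snd.comp (t, x, u) hφ)
  have hU : ContDiffAt ℝ ∞ (cU φ) (t, x, u) :=
    contDiffAt_snd.comp (t, x, u) (contDiffAt_snd.comp (t, x, u) hφ)
  have e0 : (0 : ℝ) * α + b⁻¹ * β = b⁻¹ * β := by ring
  -- As `T` depends on `t` only, the direction mapped to the `x̃`-direction has no `t`-component and
  -- its `x`-component is `1 / b`; `f_tt` plays no role and is set to zero.
  have key := (h.jet hp hφ α β γ 0 0 b⁻¹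
    ((∂₁ (cU φ) (t, x, u) + α * ∂₃ (cU φ) (t, x, u)
        - n * (∂₁ (cX φ) (t, x, u) + α * ∂₃ (cX φ) (t, x, u))) / ∂₁ (cT φ) (t, x, u)) n
    (by
      rw [at_eq, ax_eq, ax_eq, hT2, hT3, hb, mul_zero, mul_zero, zero_add, zero_mul, sub_zero,
        add_zero]
      exact mul_ne_zero h1 hb0)
    (by rw [e0]; exact hTv _ hp)
    (by rw [pd_space]; field_simp; linear_combination hb)
    (by rw [at_eq, at_eq, at_eq, hT3]; field_simp; ring)
    (by rw [ax_eq, ax_eq, ax_eq, hT3, hT2, hb, hn]; ring)).1 hs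
  rw [e0, pd_pd_vert hX, pd_pd_vert hU, pd_eq_zero hΩ hTv _ _ hp, hT3] at key
  refine Eq.trans ?_ key
  rw [inv_pow]
  ring

/-- In a point transformation between two equations of the class, `x̃` does not depend on `u`. -/
lemma MapsEquation.cX_indep {Ω : Set Space} {φ : Space → Space} {θ θ' : Coeffs}
    (h : MapsEquation Ω φ θ θ') (hΩ : IsOpen Ω) {p : Space} (hp : p ∈ Ω)
    (hφ : ContDiffAt ℝ ∞ φ p)
    (h2 : ∀ p ∈ Ω, ∂₂ (cT φ) p = 0) (h3 : ∀ p ∈ Ω, ∂₃ (cT φ) p = 0)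
    (h1 : ∂₁ (cT φ) p ≠ 0)
    (hδ : ∂₂ (cX φ) p * ∂₃ (cU φ) p - ∂₃ (cX φ) p * ∂₂ (cU φ) p ≠ 0)
    (hA : θ.A2 (base p) ≠ 0) :
    ∂₃ (cX φ) p = 0 ∧ ∂₂ (cX φ) p ≠ 0 ∧ ∂₃ (cU φ) p ≠ 0 ∧
      θ.A2 (base p) * ∂₂ (cX φ) p ^ 2 = θ'.A2 (base (φ p)) * ∂₁ (cT φ) p := by
  obtain ⟨t, x, u⟩ := p
  simp only [base] at hA
  -- With `β` fixed, the equation is affine in `α` once `γ` is eliminated; the difference between `α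
  -- = 1` and `α = 0` relates `A²` and `Ã²`.
  have main : ∀ β : ℝ, ∂₂ (cX φ) (t, x, u) + β * ∂₃ (cX φ) (t, x, u) ≠ 0 →
      θ.A2 (t, x) * (∂₂ (cX φ) (t, x, u) + β * ∂₃ (cX φ) (t, x, u)) ^ 2
        = θ'.A2 (base (φ (t, x, u))) * ∂₁ (cT φ) (t, x, u) := by
    intro β hb0
    set b := ∂₂ (cX φ) (t, x, u) + β * ∂₃ (cX φ) (t, x, u) with hb
    have hsol : ∀ α : ℝ, α + u * β - θ.A2 (t, x) * ((α + u * β - θ.A1 (t, x) * β) / θ.A2 (t, x))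
        - θ.A1 (t, x) * β = 0 := fun α => by
      field_simp; ring
    have key := fun α => h.jet_vert hΩ hp hφ h2 h3 h1 α β _
      ((∂₂ (cU φ) (t, x, u) + β * ∂₃ (cU φ) (t, x, u)) / b) b hb.symm hb0 (by field_simp) (hsol α)
    have k0 := key 0
    have k1 := key 1
    have hκ : (∂₃ (cU φ) (t, x, u)
        - (∂₂ (cU φ) (t, x, u) + β * ∂₃ (cU φ) (t, x, u)) / b * ∂₃ (cX φ) (t, x, u)) ≠ 0 := by
      have : (∂₃ (cU φ) (t, x, u)
        - (∂₂ (cU φ) (t, x, u) + β * ∂₃ (cU φ) (t, x, u)) / b * ∂₃ (cX φ) (t, x, u))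
        = (∂₂ (cX φ) (t, x, u) * ∂₃ (cU φ) (t, x, u)
          - ∂₃ (cX φ) (t, x, u) * ∂₂ (cU φ) (t, x, u)) / b := by
        field_simp
        rw [hb]
        ring
      rw [this]
      exact div_ne_zero hδ hb0
    set κ := ∂₃ (cU φ) (t, x, u)
        - (∂₂ (cU φ) (t, x, u) + β * ∂₃ (cU φ) (t, x, u)) / b * ∂₃ (cX φ) (t, x, u) with hκd
    have e : κ / ∂₁ (cT φ) (t, x, u)
        - θ'.A2 (base (φ (t, x, u))) / b ^ 2 * (κ / θ.A2 (t, x)) = 0 := by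
      linear_combination k1 - k0
    field_simp at e
    refine mul_left_cancel₀ hκ ?_
    linear_combination e
  -- Otherwise `β` can be chosen to make `X_x + β X_u` equal to `1` and to `2`, while its square
  -- times `A²` stays the same, contrary to `A² ≠ 0`.
  have hX3 : ∂₃ (cX φ) (t, x, u) = 0 := by
    by_contra h0
    have hβ : ∀ c : ℝ, ∂₂ (cX φ) (t, x, u)
        + (c - ∂₂ (cX φ) (t, x, u)) / ∂₃ (cX φ) (t, x, u) * ∂₃ (cX φ) (t, x, u) = c := fun c => by
      field_simp; ring
    have m1 := main ((1 - ∂₂ (cX φ) (t, x, u)) / ∂₃ (cX φ) (t, x, u)) (by rw [hβ]; norm_num)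
    have m2 := main ((2 - ∂₂ (cX φ) (t, x, u)) / ∂₃ (cX φ) (t, x, u)) (by rw [hβ]; norm_num)
    rw [hβ] at m1 m2
    exact hA (by linear_combination (m2 - m1) / 3)
  rw [hX3] at hδ
  have hX2 : ∂₂ (cX φ) (t, x, u) ≠ 0 := fun h0 => hδ (by rw [h0]; ring)
  refine ⟨hX3, hX2, fun h0 => hδ (by rw [h0]; ring), ?_⟩
  have := main 0 (by simpa using hX2)
  rw [zero_mul, add_zero] at this
  exact this

/-- The determining equations for a point transformation with `t̃ = T(t)`, `x̃ = X(t, x)`. -/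
lemma MapsEquation.determining {Ω : Set Space} {φ : Space → Space} {θ θ' : Coeffs}
    (h : MapsEquation Ω φ θ θ') (hΩ : IsOpen Ω) {p : Space} (hp : p ∈ Ω)
    (hφ : ContDiffAt ℝ ∞ φ p)
    (h2 : ∀ p ∈ Ω, ∂₂ (cT φ) p = 0) (h3 : ∀ p ∈ Ω, ∂₃ (cT φ) p = 0)
    (h1 : ∂₁ (cT φ) p ≠ 0) (hX : ∀ p ∈ Ω, ∂₃ (cX φ) p = 0) (hX2 : ∂₂ (cX φ) p ≠ 0)
    (hA : θ.A2 (base p) ≠ 0)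
    (hA2 : θ.A2 (base p) * ∂₂ (cX φ) p ^ 2 = θ'.A2 (base (φ p)) * ∂₁ (cT φ) p) :
    ∂₃ (∂₃ (cU φ)) p = 0 ∧
    ∂₃ (cU φ) p * ((∂₁ (cT φ) p * (cU φ p - θ'.A1 (base (φ p))) - ∂₁ (cX φ) p
        + θ.A2 (base p) * ∂₂ (∂₂ (cX φ)) p) / ∂₂ (cX φ) p - p.2.2 + θ.A1 (base p))
      = 2 * θ.A2 (base p) * ∂₂ (∂₃ (cU φ)) p ∧
    ∂₁ (cU φ) p + ∂₂ (cU φ) p * ((∂₁ (cT φ) p * (cU φ p - θ'.A1 (base (φ p))) - ∂₁ (cX φ) p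
        + θ.A2 (base p) * ∂₂ (∂₂ (cX φ)) p) / ∂₂ (cX φ) p)
      = θ.A2 (base p) * ∂₂ (∂₂ (cU φ)) p := by
  obtain ⟨t, x, u⟩ := p
  simp only [base] at hA
  have hsX : ContDiffAt ℝ ∞ (cX φ) (t, x, u) :=
    contDiffAt_fst.comp (t, x, u) (contDiffAt_snd.comp (t, x, u) hφ)
  have hX3 := hX _ hp
  have hX33 := pd_eq_zero hΩ hX (0, 0, 1) _ hp
  have hX23 := pd_eq_zero hΩ hX (0, 1, 0) _ hp
  -- The dependence on `α` is already accounted for by `hA2`, so `α = 0` suffices. The result is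
  -- quadratic in `β`, and the values at `0`, `1`, `-1` give its coefficients.
  have key := fun β : ℝ => h.jet_vert hΩ hp hφ h2 h3 h1 0 β
    ((u - θ.A1 (t, x)) * β / θ.A2 (t, x))
    ((∂₂ (cU φ) (t, x, u) + β * ∂₃ (cU φ) (t, x, u)) / ∂₂ (cX φ) (t, x, u))
    (∂₂ (cX φ) (t, x, u)) (by rw [hX3]; ring) hX2 (by field_simp) (by field_simp; ring)
  have hA2' : θ'.A2 (base (φ (t, x, u)))
      = θ.A2 (t, x) * ∂₂ (cX φ) (t, x, u) ^ 2 / ∂₁ (cT φ) (t, x, u) := by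
    rw [eq_div_iff h1]
    exact hA2.symm
  simp only [hX3, hX33, hX23, hA2'] at key
  simp only [base] at key ⊢
  have k0 := key 0
  have k1 := key 1
  have k2 := key (-1)
  field_simp at k0 k1 k2
  refine ⟨?_, ?_, ?_⟩
  · have : θ.A2 (t, x) * ∂₂ (cX φ) (t, x, u) * (2 * ∂₃ (∂₃ (cU φ)) (t, x, u)) = 0 := by
      linear_combination 2 * k0 - k1 - k2
    have := (mul_eq_zero.1 this).resolve_left (mul_ne_zero hA hX2)
    linarith
  · field_simp
    linear_combination (k1 - k2) / 2
  · field_simp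
    linear_combination k0

-- Differential consequences of the determining equations

attribute [local fun_prop] contDiffAt_pd

lemma pd_coord_u (v p : Space) : pd v (fun r : Space => r.2.2) p = v.2.2 := by
  have : HasFDerivAt (fun r : Space => r.2.2) ((ContinuousLinearMap.snd ℝ ℝ ℝ).comp
      (ContinuousLinearMap.snd ℝ ℝ (ℝ × ℝ))) p :=
    ((ContinuousLinearMap.snd ℝ ℝ ℝ).comp (ContinuousLinearMap.snd ℝ ℝ (ℝ × ℝ))).hasFDerivAt
  rw [pd, this.fderiv]
  rfl

/-- The consequences of the determining equations: `U` is affine in `u` with a coefficient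
depending on `t` only, and `U_x` satisfies a linear ordinary differential equation in `t`. -/
lemma solve_determining {Ω : Set Space} (hΩ : IsOpen Ω) {T X U a₁ a₂ B : Space → ℝ}
    (sT : ∀ p ∈ Ω, ContDiffAt ℝ ∞ T p) (sX : ∀ p ∈ Ω, ContDiffAt ℝ ∞ X p)
    (sU : ∀ p ∈ Ω, ContDiffAt ℝ ∞ U p) (s₁ : ∀ p ∈ Ω, ContDiffAt ℝ ∞ a₁ p)
    (s₂ : ∀ p ∈ Ω, ContDiffAt ℝ ∞ a₂ p) (sB : ∀ p ∈ Ω, ContDiffAt ℝ ∞ B p)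
    (T2 : ∀ p ∈ Ω, ∂₂ T p = 0) (T3 : ∀ p ∈ Ω, ∂₃ T p = 0) (X3 : ∀ p ∈ Ω, ∂₃ X p = 0)
    (a13 : ∀ p ∈ Ω, ∂₃ a₁ p = 0) (a23 : ∀ p ∈ Ω, ∂₃ a₂ p = 0) (B3 : ∀ p ∈ Ω, ∂₃ B p = 0)
    (X2 : ∀ p ∈ Ω, ∂₂ X p ≠ 0) (U3 : ∀ p ∈ Ω, ∂₃ U p ≠ 0)
    (U33 : ∀ p ∈ Ω, ∂₃ (∂₃ U) p = 0)
    (e₁ : ∀ p ∈ Ω, ∂₃ U p * (∂₁ T p * (U p - B p) - ∂₁ X p + a₂ p * ∂₂ (∂₂ X) p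
      - ∂₂ X p * (p.2.2 - a₁ p)) = 2 * (a₂ p * ∂₂ X p * ∂₂ (∂₃ U) p))
    (e₀ : ∀ p ∈ Ω, ∂₂ X p * ∂₁ U p + ∂₂ U p * (∂₁ T p * (U p - B p) - ∂₁ X p
      + a₂ p * ∂₂ (∂₂ X) p) = a₂ p * (∂₂ X p * ∂₂ (∂₂ U) p)) :
    ∀ p ∈ Ω, ∂₂ X p = ∂₁ T p * ∂₃ U p ∧ ∂₂ (∂₃ U) p = 0 ∧ ∂₁ (∂₃ U) p + ∂₂ U p = 0 ∧
      ∂₂ (∂₂ U) p = 0 ∧ ∂₁ U p + ∂₂ U p * (p.2.2 - a₁ p) = 0 ∧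
      ∂₁ T p * (U p - B p) - ∂₁ X p = ∂₂ X p * (p.2.2 - a₁ p) ∧
      ∂₁ (∂₂ U) p = ∂₂ a₁ p * ∂₂ U p ∧ ∂₂ U p * ∂₂ (∂₂ a₁) p = 0 := by
  have T13 : ∀ p ∈ Ω, ∂₃ (∂₁ T) p = 0 := fun p hp => by
    rw [pd_comm (sT p hp)]; exact pd_eq_zero hΩ T3 _ p hp
  have T12 : ∀ p ∈ Ω, ∂₂ (∂₁ T) p = 0 := fun p hp => by
    rw [pd_comm (sT p hp)]; exact pd_eq_zero hΩ T2 _ p hp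
  have X13 : ∀ p ∈ Ω, ∂₃ (∂₁ X) p = 0 := fun p hp => by
    rw [pd_comm (sX p hp)]; exact pd_eq_zero hΩ X3 _ p hp
  have X23 : ∀ p ∈ Ω, ∂₃ (∂₂ X) p = 0 := fun p hp => by
    rw [pd_comm (sX p hp)]; exact pd_eq_zero hΩ X3 _ p hp
  have X223 : ∀ p ∈ Ω, ∂₃ (∂₂ (∂₂ X)) p = 0 := fun p hp => by
    rw [pd_comm (contDiffAt_pd (sX p hp) _)]; exact pd_eq_zero hΩ X23 _ p hp
  have U323 : ∀ p ∈ Ω, ∂₃ (∂₂ (∂₃ U)) p = 0 := fun p hp => by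
    rw [pd_comm (contDiffAt_pd (sU p hp) _)]; exact pd_eq_zero hΩ U33 _ p hp
  have U313 : ∀ p ∈ Ω, ∂₃ (∂₁ (∂₃ U)) p = 0 := fun p hp => by
    rw [pd_comm (contDiffAt_pd (sU p hp) _)]; exact pd_eq_zero hΩ U33 _ p hp
  have U32 : ∀ p ∈ Ω, ∂₃ (∂₂ U) p = ∂₂ (∂₃ U) p := fun p hp => pd_comm (sU p hp) _ _
  have U31 : ∀ p ∈ Ω, ∂₃ (∂₁ U) p = ∂₁ (∂₃ U) p := fun p hp => pd_comm (sU p hp) _ _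
  have U322 : ∀ p ∈ Ω, ∂₃ (∂₂ (∂₂ U)) p = ∂₂ (∂₂ (∂₃ U)) p := fun p hp => by
    rw [pd_comm (contDiffAt_pd (sU p hp) _)]; exact pd_congr hΩ U32 _ p hp
  have U3223 : ∀ p ∈ Ω, ∂₃ (∂₂ (∂₂ (∂₃ U))) p = 0 := fun p hp => by
    rw [pd_comm (contDiffAt_pd (contDiffAt_pd (sU p hp) _) _)]; exact pd_eq_zero hΩ U323 _ p hp
  -- The `u`-derivative of `e₁`, divided by `U_u`.
  have r₁ : ∀ p ∈ Ω, ∂₂ X p = ∂₁ T p * ∂₃ U p := fun p hp => by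
    have h := pd_congr hΩ e₁ (0, 0, 1) p hp
    have := sT p hp; have := sX p hp; have := sU p hp
    have := s₁ p hp; have := s₂ p hp; have := sB p hp
    simp (disch := fun_prop) only [pd_mul, pd_add, pd_sub, pd_const, pd_coord_u, T13 p hp,
      X13 p hp, X23 p hp, X223 p hp, U323 p hp, U33 p hp, a13 p hp, a23 p hp, B3 p hp] at h
    refine mul_left_cancel₀ (U3 p hp) ?_
    linear_combination -h
  have e₂ : ∀ p ∈ Ω, ∂₂ X p * ∂₁ (∂₃ U) p + ∂₂ (∂₃ U) p * (∂₁ T p * (U p - B p) - ∂₁ X p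
      + a₂ p * ∂₂ (∂₂ X) p) + ∂₂ U p * ∂₂ X p = a₂ p * (∂₂ X p * ∂₂ (∂₂ (∂₃ U)) p) :=
    fun p hp => by
    have h := pd_congr hΩ e₀ (0, 0, 1) p hp
    have := sT p hp; have := sX p hp; have := sU p hp
    have := s₁ p hp; have := s₂ p hp; have := sB p hp
    simp (disch := fun_prop) only [pd_mul, pd_add, pd_sub, T13 p hp,
      X13 p hp, X23 p hp, X223 p hp, U31 p hp, U32 p hp, U322 p hp, a23 p hp, B3 p hp] at h
    linear_combination h + ∂₂ U p * r₁ p hp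
  -- Differentiating `e₀` twice in `u` leaves `U_xu (T_t U_u + X_x) = 0`, and by `r₁` the bracket is
  -- `2 X_x`.
  have r₂ : ∀ p ∈ Ω, ∂₂ (∂₃ U) p = 0 := fun p hp => by
    have h := pd_congr hΩ e₂ (0, 0, 1) p hp
    have := sT p hp; have := sX p hp; have := sU p hp
    have := s₁ p hp; have := s₂ p hp; have := sB p hp
    simp (disch := fun_prop) only [pd_mul, pd_add, pd_sub, T13 p hp,
      X13 p hp, X23 p hp, X223 p hp, U313 p hp, U32 p hp, U323 p hp, U3223 p hp, a23 p hp,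
      B3 p hp] at h
    refine (mul_eq_zero.1 (?_ : 2 * ∂₂ X p * _ = 0)).resolve_left
      (mul_ne_zero two_ne_zero (X2 p hp))
    linear_combination h + ∂₂ (∂₃ U) p * r₁ p hp
  have X22 : ∀ p ∈ Ω, ∂₂ (∂₂ X) p = 0 := fun p hp => by
    have h := pd_congr hΩ r₁ (0, 1, 0) p hp
    rw [pd_mul (contDiffAt_pd (sT p hp) _) (contDiffAt_pd (sU p hp) _), T12 p hp, r₂ p hp] at h
    rw [h]; ring
  have r₃ : ∀ p ∈ Ω, ∂₁ (∂₃ U) p + ∂₂ U p = 0 := fun p hp => by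
    have h := e₂ p hp
    rw [r₂ p hp, pd_eq_zero hΩ r₂ _ p hp] at h
    refine mul_left_cancel₀ (X2 p hp) ?_
    linear_combination h
  have r₄ : ∀ p ∈ Ω, ∂₂ (∂₂ U) p = 0 := fun p hp => by
    have h := pd_eq_zero hΩ r₃ (0, 1, 0) p hp
    have h3 := contDiffAt_pd (sU p hp) (0, 0, 1)
    rw [pd_add (contDiffAt_pd h3 _) (contDiffAt_pd (sU p hp) _), pd_comm h3,
      pd_eq_zero hΩ r₂ _ p hp, zero_add] at h
    exact h
  have r₆ : ∀ p ∈ Ω, ∂₁ T p * (U p - B p) - ∂₁ X p = ∂₂ X p * (p.2.2 - a₁ p) := fun p hp => by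
    have h := e₁ p hp
    rw [r₂ p hp, X22 p hp] at h
    refine mul_left_cancel₀ (U3 p hp) ?_
    linear_combination h
  have r₅ : ∀ p ∈ Ω, ∂₁ U p + ∂₂ U p * (p.2.2 - a₁ p) = 0 := fun p hp => by
    have h := e₀ p hp
    rw [r₄ p hp, X22 p hp] at h
    refine mul_left_cancel₀ (X2 p hp) ?_
    linear_combination h - ∂₂ U p * r₆ p hp
  -- The `x`-derivative of `r₅`. A further `x`-derivative, with `U_xx = 0`, gives the classifying
  -- condition `U_x A¹_xx = 0`.
  have r₇ : ∀ p ∈ Ω, ∂₁ (∂₂ U) p = ∂₂ a₁ p * ∂₂ U p := fun p hp => by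
    have h := pd_eq_zero hΩ r₅ (0, 1, 0) p hp
    have := sU p hp; have := s₁ p hp
    simp (disch := fun_prop) only [pd_mul, pd_add, pd_sub, pd_coord_u, r₄ p hp,
      pd_comm (sU p hp) (0, 1, 0) (1, 0, 0)] at h
    linear_combination h
  refine fun p hp => ⟨r₁ p hp, r₂ p hp, r₃ p hp, r₄ p hp, r₅ p hp, r₆ p hp, r₇ p hp, ?_⟩
  have h := pd_congr hΩ r₇ (0, 1, 0) p hp
  rw [pd_comm (contDiffAt_pd (sU p hp) _), pd_eq_zero hΩ r₄ _ p hp,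
    pd_mul (contDiffAt_pd (s₁ p hp) _) (contDiffAt_pd (sU p hp) _), r₄ p hp] at h
  linear_combination -h

/-! ### Integration over domains -/

/-- A solution of the linear equations `W_t = c W`, `W_x = W_u = 0` on a connected open set that
vanishes at one point vanishes identically. -/
lemma eq_zero_of_linear_ode {Ω : Set Space} (hΩ : IsOpen Ω) (hc : IsPreconnected Ω)
    {W c : Space → ℝ} (sW : ∀ p ∈ Ω, ContDiffAt ℝ ∞ W p) (sc : ContinuousOn c Ω)
    (W1 : ∀ p ∈ Ω, ∂₁ W p = c p * W p) (W2 : ∀ p ∈ Ω, ∂₂ W p = 0) (W3 : ∀ p ∈ Ω, ∂₃ W p = 0)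
    {p₀ : Space} (hp₀ : p₀ ∈ Ω) (h0 : W p₀ = 0) : ∀ p ∈ Ω, W p = 0 := by
  have loc : ∀ p ∈ Ω, W p = 0 → ∀ᶠ r in 𝓝 p, r ∈ Ω ∧ W r = 0 := by
    intro p hp hW
    have hcont : ContinuousAt c p := sc.continuousAt (hΩ.mem_nhds hp)
    have hbd : ∀ᶠ r in 𝓝 p, r ∈ Ω ∧ |c r| < |c p| + 1 :=
      Filter.Eventually.and (hΩ.mem_nhds hp) (hcont.abs.eventually (gt_mem_nhds (by linarith)))
    obtain ⟨ε, hε, hball⟩ := Metric.eventually_nhds_iff_ball.1 hbd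
    refine Metric.eventually_nhds_iff_ball.2 ⟨ε, hε, fun r hr => ⟨(hball r hr).1, ?_⟩⟩
    have hseg : ∀ s ∈ Icc (0 : ℝ) 1, p + s • (r - p) ∈ Metric.ball p ε := fun s hs =>
      (convex_ball p ε).add_smul_sub_mem (Metric.mem_ball_self hε) hr hs
    have hder : ∀ s ∈ Icc (0 : ℝ) 1, HasDerivAt (fun s : ℝ => W (p + s • (r - p)))
        ((r - p).1 * (c (p + s • (r - p)) * W (p + s • (r - p)))) s := by
      intro s hs
      have hm := (hball _ (hseg s hs)).1
      have h1 : HasDerivAt (fun s : ℝ => p + s • (r - p)) ((1 : ℝ) • (r - p)) s :=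
        ((hasDerivAt_id s).smul_const (r - p)).const_add p
      have h2 := (diffAt (sW _ hm)).hasFDerivAt.comp_hasDerivAt s h1
      refine h2.congr_deriv ?_
      change pd _ W _ = _
      rw [one_smul, pd_space (r - p).1 (r - p).2.1 (r - p).2.2, W1 _ hm, W2 _ hm, W3 _ hm]
      ring
    -- On the segment from `p` to `r` the derivative of `W` is bounded by a constant times `|W|`,
    -- and `W` starts at zero, so Grönwall's bound is zero.
    have hg := norm_le_gronwallBound_of_norm_deriv_right_le (δ := 0) (ε := 0)
      (K := |(r - p).1| * (|c p| + 1)) (a := 0) (b := 1)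
      (fun s hs => (hder s hs).continuousAt.continuousWithinAt)
      (fun s hs => (hder s (Ico_subset_Icc_self hs)).hasDerivWithinAt)
      (by simp [hW])
      (fun s hs => by
        rw [norm_mul, norm_mul, add_zero, mul_assoc, Real.norm_eq_abs, Real.norm_eq_abs]
        have := (hball _ (hseg s (Ico_subset_Icc_self hs))).2.le
        gcongr) 1 (by simp)
    rw [gronwallBound_ε0_δ0] at hg
    simpa using hg
  let Z : Set Space := {r | r ∈ Ω ∧ W r = 0}
  have hZo : IsOpen Z := isOpen_iff_mem_nhds.2 fun p hp => loc p hp.1 hp.2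
  -- The zero set is open by `loc` and relatively closed by continuity.
  have hsub : Ω ⊆ Z := by
    refine hc.subset_of_closure_inter_subset hZo ⟨p₀, hp₀, hp₀, h0⟩ ?_
    rintro p ⟨hcl, hp⟩
    refine ⟨hp, ?_⟩
    have hcont : ContinuousAt W p := (sW p hp).continuousAt
    by_contra hne
    obtain ⟨r, hr1, hr2⟩ := mem_closure_iff_nhds.1 hcl _ (hcont.eventually_ne hne)
    exact hr1 hr2.2
  exact fun p hp => (hsub hp).2

lemma fderiv_eq_zero_of_pd {F : Space → ℝ} {p : Space} (h1 : ∂₁ F p = 0) (h2 : ∂₂ F p = 0)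
    (h3 : ∂₃ F p = 0) : fderiv ℝ F p = 0 := by
  refine ContinuousLinearMap.ext fun v => ?_
  have := pd_space v.1 v.2.1 v.2.2 F p
  rw [h1, h2, h3, mul_zero, mul_zero, mul_zero, add_zero, add_zero] at this
  exact this

lemma IsDom.exists_const {Ω : Set Space} (hΩ : IsDom Ω) {F : Space → ℝ}
    (sF : ∀ p ∈ Ω, ContDiffAt ℝ ∞ F p) (h1 : ∀ p ∈ Ω, ∂₁ F p = 0) (h2 : ∀ p ∈ Ω, ∂₂ F p = 0)
    (h3 : ∀ p ∈ Ω, ∂₃ F p = 0) : ∃ c : ℝ, ∀ p ∈ Ω, F p = c :=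
  hΩ.isOpen.exists_is_const_of_fderiv_eq_zero hΩ.isConnected.isPreconnected
    (fun p hp => (diffAt (sF p hp)).differentiableWithinAt)
    (fun p hp => fderiv_eq_zero_of_pd (h1 p hp) (h2 p hp) (h3 p hp))

lemma IsDom.isOpen_fst {Ω : Set Space} (hΩ : IsDom Ω) : IsOpen (Prod.fst '' Ω) :=
  isOpenMap_fst _ hΩ.isOpen

/-- A function with vanishing derivatives in `x` and `u` is a function of `t`. -/
lemma IsDom.exists_eq_comp_fst {Ω : Set Space} (hΩ : IsDom Ω) {F : Space → ℝ}
    (sF : ∀ p ∈ Ω, ContDiffAt ℝ ∞ F p) (h2 : ∀ p ∈ Ω, ∂₂ F p = 0) (h3 : ∀ p ∈ Ω, ∂₃ F p = 0) :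
    ∃ g : ℝ → ℝ, ContDiffOn ℝ ∞ g (Prod.fst '' Ω) ∧ ∀ p ∈ Ω, F p = g p.1 := by
  have slice : ∀ t : ℝ, ∀ q ∈ {q : ℝ × ℝ | (t, q) ∈ Ω}, ∀ q' ∈ {q : ℝ × ℝ | (t, q) ∈ Ω},
      F (t, q) = F (t, q') := by
    intro t q hq q' hq'
    have ho : IsOpen {q : ℝ × ℝ | (t, q) ∈ Ω} := hΩ.isOpen.preimage (by fun_prop)
    have hfd : ∀ q ∈ {q : ℝ × ℝ | (t, q) ∈ Ω},
        HasFDerivAt (fun q : ℝ × ℝ => F (t, q)) (0 : ℝ × ℝ →L[ℝ] ℝ) q := by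
      intro q hq
      have h := (diffAt (sF _ hq)).hasFDerivAt.comp q (hasFDerivAt_prodMk_right t q)
      refine h.congr_fderiv ?_
      refine ContinuousLinearMap.ext fun v => ?_
      change pd (0, v.1, v.2) F (t, q) = 0
      rw [pd_space, h2 _ hq, h3 _ hq]
      ring
    exact ho.is_const_of_fderiv_eq_zero (hΩ.slice t)
      (fun q hq => (hfd q hq).differentiableAt.differentiableWithinAt)
      (fun q hq => (hfd q hq).fderiv) hq hq'
  choose! s hs using fun (t : ℝ) (ht : t ∈ Prod.fst '' Ω) =>
    (show ∃ q : ℝ × ℝ, (t, q) ∈ Ω by obtain ⟨p, hp, rfl⟩ := ht; exact ⟨p.2, hp⟩)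
  have heq : ∀ p ∈ Ω, F p = F (p.1, s p.1) := fun p hp =>
    slice p.1 p.2 hp _ (hs p.1 ⟨p, hp, rfl⟩)
  refine ⟨fun t => F (t, s t), ?_, heq⟩
  rintro _ ⟨p, hp, rfl⟩
  -- The choice `s` need not be continuous: near `p.1` the function agrees with `F` along the line
  -- with `(x, u) = p.2` fixed.
  have hc : ContDiffAt ℝ ∞ (fun t : ℝ => F (t, p.2)) p.1 :=
    ContDiffAt.comp p.1 (g := F) (f := fun t : ℝ => (t, p.2)) (sF p hp)
      (contDiffAt_id.prodMk contDiffAt_const)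
  refine (hc.congr_of_eventuallyEq ?_).contDiffWithinAt
  have hmem : ∀ᶠ t : ℝ in 𝓝 p.1, (t, p.2) ∈ Ω :=
    (show Continuous fun t : ℝ => (t, p.2) by fun_prop).continuousAt.eventually
      (hΩ.isOpen.mem_nhds hp)
  filter_upwards [hmem] with t ht
  exact (heq (t, p.2) ht).symm

/-! ### Functions of `t` and of `(t, x)` as functions of `(t, x, u)` -/

lemma pd_comp_fst {g : ℝ → ℝ} {p : Space} (hg : DifferentiableAt ℝ g p.1) (v : Space) :
    pd v (fun r : Space => g r.1) p = v.1 * deriv g p.1 := by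
  have h := hg.hasDerivAt.comp_hasFDerivAt p (hasFDerivAt_fst (𝕜 := ℝ) (p := p))
  have h' : HasFDerivAt (fun r : Space => g r.1) _ p := h
  rw [pd, h'.fderiv]
  simp [mul_comm]

lemma isOpenMap_base : IsOpenMap base :=
  IsOpenMap.id.prodMap isOpenMap_fst

lemma contDiff_base : ContDiff ℝ ∞ base :=
  contDiff_fst.prodMk (contDiff_fst.comp contDiff_snd)

lemma pd_comp_base {A : Plane → ℝ} {p : Space} (hA : DifferentiableAt ℝ A (base p)) (v : Space) :
    pd v (fun r => A (base r)) p = pd (v.1, v.2.1) A (base p) := by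
  rw [pd_comp hA (contDiff_base.differentiable (by simp) p)]
  have : HasFDerivAt base ((ContinuousLinearMap.fst ℝ ℝ (ℝ × ℝ)).prod
      ((ContinuousLinearMap.fst ℝ ℝ ℝ).comp (ContinuousLinearMap.snd ℝ ℝ (ℝ × ℝ)))) p :=
    ((ContinuousLinearMap.fst ℝ ℝ (ℝ × ℝ)).prod
      ((ContinuousLinearMap.fst ℝ ℝ ℝ).comp (ContinuousLinearMap.snd ℝ ℝ (ℝ × ℝ)))).hasFDerivAt
  rw [this.fderiv]
  rfl

lemma contDiffAt_cT {φ : Space → Space} {p : Space} (h : ContDiffAt ℝ ∞ φ p) :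
    ContDiffAt ℝ ∞ (cT φ) p := contDiffAt_fst.comp p h

lemma contDiffAt_cX {φ : Space → Space} {p : Space} (h : ContDiffAt ℝ ∞ φ p) :
    ContDiffAt ℝ ∞ (cX φ) p := contDiffAt_fst.comp p (contDiffAt_snd.comp p h)

lemma contDiffAt_cU {φ : Space → Space} {p : Space} (h : ContDiffAt ℝ ∞ φ p) :
    ContDiffAt ℝ ∞ (cU φ) p := contDiffAt_snd.comp p (contDiffAt_snd.comp p h)

lemma contDiffAt_comp_base {A : Plane → ℝ} {p : Space} (h : ContDiffAt ℝ ∞ A (base p)) :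
    ContDiffAt ℝ ∞ (fun r => A (base r)) p :=
  ContDiffAt.comp p (g := A) h contDiff_base.contDiffAt

/-- A point transformation between two equations of the class, the first one with `A¹_xx` not
vanishing identically, in terms of the derivatives of its components. -/
theorem MapsEquation.components {Ω Ω' : Set Space} {φ : Space → Space} {θ θ' : Coeffs}
    (h : MapsEquation Ω φ θ θ') (dΩ : IsDom Ω) (hΩ' : IsOpen Ω') (hφ : IsDiffeo φ Ω Ω')
    (hθ : θ ∈ wholeClass (base '' Ω)) (hθ' : θ' ∈ wholeClass (base '' Ω'))
    (hreg : ∃ q ∈ base '' Ω, dx (dx θ.A1) q ≠ 0) :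
    ∀ p ∈ Ω, ∂₁ (cT φ) p ≠ 0 ∧ ∂₂ (cT φ) p = 0 ∧ ∂₃ (cT φ) p = 0 ∧ ∂₃ (cX φ) p = 0 ∧
      ∂₃ (cU φ) p ≠ 0 ∧ ∂₂ (cX φ) p = ∂₁ (cT φ) p * ∂₃ (cU φ) p ∧
      ∂₁ (cU φ) p = 0 ∧ ∂₂ (cU φ) p = 0 ∧ ∂₁ (∂₃ (cU φ)) p = 0 ∧ ∂₂ (∂₃ (cU φ)) p = 0 ∧
      ∂₃ (∂₃ (cU φ)) p = 0 ∧
      θ'.A1 (base (φ p)) = ∂₃ (cU φ) p * θ.A1 (base p) + (cU φ p - ∂₃ (cU φ) p * p.2.2)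
        - ∂₁ (cX φ) p / ∂₁ (cT φ) p ∧
      θ'.A2 (base (φ p)) = ∂₁ (cT φ) p * ∂₃ (cU φ) p ^ 2 * θ.A2 (base p) := by
  have hΩ := dΩ.isOpen
  have sφ : ∀ p ∈ Ω, ContDiffAt ℝ ∞ φ p := fun p hp => hφ.1.contDiffAt (hΩ.mem_nhds hp)
  have sT : ∀ p ∈ Ω, ContDiffAt ℝ ∞ (cT φ) p := fun p hp => contDiffAt_cT (sφ p hp)
  have sX : ∀ p ∈ Ω, ContDiffAt ℝ ∞ (cX φ) p := fun p hp => contDiffAt_cX (sφ p hp)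
  have sU : ∀ p ∈ Ω, ContDiffAt ℝ ∞ (cU φ) p := fun p hp => contDiffAt_cU (sφ p hp)
  have hD := isOpenMap_base _ hΩ
  have hD' := isOpenMap_base _ hΩ'
  have hA : ∀ p ∈ Ω, θ.A2 (base p) ≠ 0 := fun p hp => hθ.2.2 _ (mem_image_of_mem _ hp)
  have hA' : ∀ p ∈ Ω, θ'.A2 (base (φ p)) ≠ 0 := fun p hp =>
    hθ'.2.2 _ (mem_image_of_mem _ (hφ.2.1 hp))
  have sA1 : ∀ p ∈ Ω, ContDiffAt ℝ ∞ θ.A1 (base p) := fun p hp =>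
    hθ.1.contDiffAt (hD.mem_nhds (mem_image_of_mem _ hp))
  have sA2 : ∀ p ∈ Ω, ContDiffAt ℝ ∞ θ.A2 (base p) := fun p hp =>
    hθ.2.1.contDiffAt (hD.mem_nhds (mem_image_of_mem _ hp))
  have sA1' : ∀ p ∈ Ω, ContDiffAt ℝ ∞ θ'.A1 (base (φ p)) := fun p hp =>
    hθ'.1.contDiffAt (hD'.mem_nhds (mem_image_of_mem _ (hφ.2.1 hp)))
  have hV := fun p (hp : p ∈ Ω) => hφ.exists_pd_eq hΩ hΩ' hp
  have T2 : ∀ p ∈ Ω, ∂₂ (cT φ) p = 0 := fun p hp =>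
    (h.cT_indep hp (sφ p hp) (hV p hp) (hA p hp) (hA' p hp)).1
  have T3 : ∀ p ∈ Ω, ∂₃ (cT φ) p = 0 := fun p hp =>
    (h.cT_indep hp (sφ p hp) (hV p hp) (hA p hp) (hA' p hp)).2
  have nd := fun p (hp : p ∈ Ω) => nondegenerate_of_cT_indep (hV p hp) (T2 p hp) (T3 p hp)
  have T1 : ∀ p ∈ Ω, ∂₁ (cT φ) p ≠ 0 := fun p hp => (nd p hp).1
  have ind := fun p (hp : p ∈ Ω) =>
    h.cX_indep hΩ hp (sφ p hp) T2 T3 (T1 p hp) (nd p hp).2 (hA p hp)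
  have X3 : ∀ p ∈ Ω, ∂₃ (cX φ) p = 0 := fun p hp => (ind p hp).1
  have det := fun p (hp : p ∈ Ω) =>
    h.determining hΩ hp (sφ p hp) T2 T3 (T1 p hp) X3 (ind p hp).2.1 (hA p hp) (ind p hp).2.2.2
  have U33 : ∀ p ∈ Ω, ∂₃ (∂₃ (cU φ)) p = 0 := fun p hp => (det p hp).1
  have sB : ∀ p ∈ Ω, ContDiffAt ℝ ∞ (fun r => θ'.A1 (base (φ r))) p := fun p hp =>
    ContDiffAt.comp p (g := fun z => θ'.A1 (base z)) (contDiffAt_comp_base (sA1' p hp)) (sφ p hp)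
  have B3 : ∀ p ∈ Ω, ∂₃ (fun r => θ'.A1 (base (φ r))) p = 0 := fun p hp => by
    have dT := diffAt (sT p hp)
    have dX := diffAt (sX p hp)
    have e := pd_comp (F := θ'.A1) (g := fun r => (cT φ r, cX φ r)) (diffAt (sA1' p hp))
      (dT.prodMk dX) (0, 0, 1)
    rw [dT.fderiv_prodMk dX] at e
    refine e.trans ?_
    have e0 : ((fderiv ℝ (cT φ) p).prod (fderiv ℝ (cX φ) p)) (0, 0, 1) = 0 :=
      Prod.ext (T3 p hp) (X3 p hp)
    rw [e0]
    exact map_zero _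
  -- The hypotheses `e₁` and `e₀` are the determining equations cleared of the denominator `X_x`.
  have sol := solve_determining hΩ sT sX sU (fun p hp => contDiffAt_comp_base (sA1 p hp))
    (fun p hp => contDiffAt_comp_base (sA2 p hp)) sB T2 T3 X3
    (fun p hp => by rw [pd_comp_base (diffAt (sA1 p hp))]; exact map_zero _)
    (fun p hp => by rw [pd_comp_base (diffAt (sA2 p hp))]; exact map_zero _) B3
    (fun p hp => (ind p hp).2.1) (fun p hp => (ind p hp).2.2.1) U33
    (fun p hp => by
      have hX2 := (ind p hp).2.1
      have e := (det p hp).2.1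
      field_simp at e
      linear_combination e)
    (fun p hp => by
      have hX2 := (ind p hp).2.1
      have e := (det p hp).2.2
      field_simp at e
      linear_combination e)
  have a12 : ∀ p ∈ Ω, ∂₂ (fun r => θ.A1 (base r)) p = dx θ.A1 (base p) := fun p hp =>
    pd_comp_base (diffAt (sA1 p hp)) _
  have a122 : ∀ p ∈ Ω, ∂₂ (∂₂ (fun r => θ.A1 (base r))) p = dx (dx θ.A1) (base p) :=
    fun p hp => by
    rw [pd_congr hΩ a12 _ p hp]
    exact pd_comp_base (diffAt (contDiffAt_pd (sA1 p hp) _)) _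
  -- The only use of `hreg`: it gives `U_x = 0` at one point, and the linear equation `U_tx = A¹_x
  -- U_x` spreads this over `Ω`.
  have U2 : ∀ p ∈ Ω, ∂₂ (cU φ) p = 0 := by
    obtain ⟨_, ⟨p₀, hp₀, rfl⟩, hne⟩ := hreg
    refine eq_zero_of_linear_ode hΩ dΩ.isConnected.isPreconnected
      (fun p hp => contDiffAt_pd (sU p hp) _)
      (c := fun p => dx θ.A1 (base p))
      (fun p hp => ((contDiffAt_comp_base (contDiffAt_pd (sA1 p hp) _)).continuousAt
        ).continuousWithinAt)
      (fun p hp => ?_) (fun p hp => (sol p hp).2.2.2.1) (fun p hp => ?_) hp₀ ?_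
    · rw [(sol p hp).2.2.2.2.2.2.1, a12 p hp]
    · rw [pd_comm (sU p hp)]
      exact (sol p hp).2.1
    · have e := (sol p₀ hp₀).2.2.2.2.2.2.2
      rw [a122 p₀ hp₀] at e
      exact (mul_eq_zero.1 e).resolve_right hne
  intro p hp
  obtain ⟨s1, s2, s3, -, s5, s6, -⟩ := sol p hp
  rw [U2 p hp] at s3 s5
  have hT := T1 p hp
  refine ⟨hT, T2 p hp, T3 p hp, X3 p hp, (ind p hp).2.2.1, s1, by linarith, U2 p hp,
    by linarith, s2, U33 p hp, ?_, ?_⟩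
  · rw [s1] at s6
    field_simp
    linear_combination -s6
  · have e := (ind p hp).2.2.2
    rw [s1] at e
    refine mul_right_cancel₀ hT ?_
    linear_combination -e

/-- The form of the `(t, x, u)`-components of the explicit transformations. -/
structure ExplicitForm (Ω : Set Space) (φ : Space → Space) (T X0 : ℝ → ℝ) (U0 U1 : ℝ) :
    Prop where
  smooth_T : ContDiffOn ℝ ∞ T (Prod.fst '' Ω)
  smooth_X0 : ContDiffOn ℝ ∞ X0 (Prod.fst '' Ω)
  deriv_ne : ∀ t ∈ Prod.fst '' Ω, deriv T t ≠ 0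
  U1_ne : U1 ≠ 0
  form : ∀ p ∈ Ω, φ p = (T p.1, deriv T p.1 * U1 * p.2.1 + X0 p.1, U1 * p.2.2 + U0)

/-! ### Derivatives of maps in explicit form -/

lemma contDiffAt_deriv {g : ℝ → ℝ} {t : ℝ} (h : ContDiffAt ℝ ∞ g t) :
    ContDiffAt ℝ ∞ (deriv g) t := contDiffAt_pd h 1

lemma contDiffAt_comp_fst {g : ℝ → ℝ} {p : Space} (h : ContDiffAt ℝ ∞ g p.1) :
    ContDiffAt ℝ ∞ (fun r : Space => g r.1) p :=
  ContDiffAt.comp p (g := g) h contDiffAt_fst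

lemma pd_coord_x (v p : Space) : pd v (fun r : Space => r.2.1) p = v.2.1 := by
  have : HasFDerivAt (fun r : Space => r.2.1) ((ContinuousLinearMap.fst ℝ ℝ ℝ).comp
      (ContinuousLinearMap.snd ℝ ℝ (ℝ × ℝ))) p :=
    ((ContinuousLinearMap.fst ℝ ℝ ℝ).comp (ContinuousLinearMap.snd ℝ ℝ (ℝ × ℝ))).hasFDerivAt
  rw [pd, this.fderiv]
  rfl

namespace ExplicitForm

variable {Ω : Set Space} {φ : Space → Space} {T X0 : ℝ → ℝ} {U0 U1 : ℝ}

lemma contDiffAt_T (h : ExplicitForm Ω φ T X0 U0 U1) (dΩ : IsDom Ω) {t : ℝ}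
    (ht : t ∈ Prod.fst '' Ω) : ContDiffAt ℝ ∞ T t :=
  h.smooth_T.contDiffAt (dΩ.isOpen_fst.mem_nhds ht)

lemma contDiffAt_X0 (h : ExplicitForm Ω φ T X0 U0 U1) (dΩ : IsDom Ω) {t : ℝ}
    (ht : t ∈ Prod.fst '' Ω) : ContDiffAt ℝ ∞ X0 t :=
  h.smooth_X0.contDiffAt (dΩ.isOpen_fst.mem_nhds ht)

lemma pd_cT (h : ExplicitForm Ω φ T X0 U0 U1) (dΩ : IsDom Ω) {p : Space} (hp : p ∈ Ω) :
    ∂₁ (cT φ) p = deriv T p.1 := by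
  rw [pd_congr (G := fun r : Space => T r.1) dΩ.isOpen
    (fun r hr => by rw [cT, h.form r hr]) _ p hp,
    pd_comp_fst (diffAt (h.contDiffAt_T dΩ ⟨p, hp, rfl⟩)), one_mul]

lemma pd_cX (h : ExplicitForm Ω φ T X0 U0 U1) (dΩ : IsDom Ω) {p : Space} (hp : p ∈ Ω) :
    ∂₁ (cX φ) p = deriv (deriv T) p.1 * U1 * p.2.1 + deriv X0 p.1 := by
  have hT := contDiffAt_deriv (h.contDiffAt_T dΩ ⟨p, hp, rfl⟩)
  have hX := h.contDiffAt_X0 dΩ ⟨p, hp, rfl⟩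
  have hT' := contDiffAt_comp_fst hT
  have hx : ContDiffAt ℝ ∞ (fun r : Space => r.2.1) p := contDiffAt_fst.comp p contDiffAt_snd
  rw [pd_congr (G := fun r : Space => deriv T r.1 * U1 * r.2.1 + X0 r.1) dΩ.isOpen
    (fun r hr => by rw [cX, h.form r hr]) _ p hp,
    pd_add ((hT'.mul contDiffAt_const).mul hx) (contDiffAt_comp_fst hX),
    pd_mul (hT'.mul contDiffAt_const) hx, pd_mul hT' contDiffAt_const, pd_const, pd_coord_x,
    pd_comp_fst (diffAt hT), pd_comp_fst (diffAt hX)]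
  ring

lemma pd_cU (h : ExplicitForm Ω φ T X0 U0 U1) (dΩ : IsDom Ω) {p : Space} (hp : p ∈ Ω) :
    ∂₃ (cU φ) p = U1 := by
  have hu : ContDiffAt ℝ ∞ (fun r : Space => r.2.2) p := contDiffAt_snd.comp p contDiffAt_snd
  rw [pd_congr (G := fun r : Space => U1 * r.2.2 + U0) dΩ.isOpen
    (fun r hr => by rw [cU, h.form r hr]) _ p hp,
    pd_add (contDiffAt_const.mul hu) contDiffAt_const, pd_const, pd_const_mul hu, pd_coord_u]
  ring

end ExplicitForm

/-- A point transformation between two equations of the class, the first one with `A¹_xx` not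
vanishing identically, has the explicit form. -/
theorem MapsEquation.exists_explicitForm {Ω Ω' : Set Space} {φ : Space → Space} {θ θ' : Coeffs}
    (h : MapsEquation Ω φ θ θ') (dΩ : IsDom Ω) (hΩ' : IsOpen Ω') (hφ : IsDiffeo φ Ω Ω')
    (hθ : θ ∈ wholeClass (base '' Ω)) (hθ' : θ' ∈ wholeClass (base '' Ω'))
    (hreg : ∃ q ∈ base '' Ω, dx (dx θ.A1) q ≠ 0) :
    ∃ (T X0 : ℝ → ℝ) (U0 U1 : ℝ), ExplicitForm Ω φ T X0 U0 U1 := by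
  have c := h.components dΩ hΩ' hφ hθ hθ' hreg
  have hΩ := dΩ.isOpen
  have sφ : ∀ p ∈ Ω, ContDiffAt ℝ ∞ φ p := fun p hp => hφ.1.contDiffAt (hΩ.mem_nhds hp)
  obtain ⟨T, sT, eT⟩ := dΩ.exists_eq_comp_fst (fun p hp => contDiffAt_cT (sφ p hp))
    (fun p hp => (c p hp).2.1) (fun p hp => (c p hp).2.2.1)
  have sT' : ∀ p ∈ Ω, ContDiffAt ℝ ∞ T p.1 := fun p hp =>
    sT.contDiffAt (dΩ.isOpen_fst.mem_nhds ⟨p, hp, rfl⟩)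
  have T1 : ∀ p ∈ Ω, ∂₁ (cT φ) p = deriv T p.1 := fun p hp => by
    rw [pd_congr hΩ eT _ p hp, pd_comp_fst (diffAt (sT' p hp)), one_mul]
  obtain ⟨U1, hU1⟩ := dΩ.exists_const (fun p hp => contDiffAt_pd (contDiffAt_cU (sφ p hp)) _)
    (fun p hp => (c p hp).2.2.2.2.2.2.2.2.1) (fun p hp => (c p hp).2.2.2.2.2.2.2.2.2.1)
    (fun p hp => (c p hp).2.2.2.2.2.2.2.2.2.2.1)
  have hu : ∀ p : Space, ContDiffAt ℝ ∞ (fun r : Space => r.2.2) p := fun p =>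
    contDiffAt_snd.comp p contDiffAt_snd
  have hx : ∀ p : Space, ContDiffAt ℝ ∞ (fun r : Space => r.2.1) p := fun p =>
    contDiffAt_fst.comp p contDiffAt_snd
  have dU : ∀ p ∈ Ω, ∀ v : Space,
      pd v (fun r => cU φ r - U1 * r.2.2) p = pd v (cU φ) p - U1 * v.2.2 := fun p hp v => by
    rw [pd_sub (contDiffAt_cU (sφ p hp)) (contDiffAt_const.mul (hu p)), pd_const_mul (hu p),
      pd_coord_u]
  obtain ⟨U0, hU0⟩ := dΩ.exists_const (F := fun r => cU φ r - U1 * r.2.2)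
    (fun p hp => (contDiffAt_cU (sφ p hp)).sub (contDiffAt_const.mul (hu p)))
    (fun p hp => by rw [dU p hp, (c p hp).2.2.2.2.2.2.1]; ring)
    (fun p hp => by rw [dU p hp, (c p hp).2.2.2.2.2.2.2.1]; ring)
    (fun p hp => by rw [dU p hp, hU1 p hp]; ring)
  have sT1 : ∀ p ∈ Ω, ContDiffAt ℝ ∞ (fun r : Space => deriv T r.1) p := fun p hp =>
    contDiffAt_comp_fst (contDiffAt_deriv (sT' p hp))
  have dX : ∀ p ∈ Ω, ∀ v : Space, v.1 = 0 →
      pd v (fun r => cX φ r - deriv T r.1 * U1 * r.2.1) p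
        = pd v (cX φ) p - deriv T p.1 * U1 * v.2.1 := fun p hp v hv => by
    rw [pd_sub (contDiffAt_cX (sφ p hp)) (((sT1 p hp).mul contDiffAt_const).mul (hx p)),
      pd_mul ((sT1 p hp).mul contDiffAt_const) (hx p), pd_mul (sT1 p hp) contDiffAt_const,
      pd_comp_fst (diffAt (contDiffAt_deriv (sT' p hp))), pd_const, pd_coord_x, hv]
    ring
  obtain ⟨X0, sX0, eX0⟩ := dΩ.exists_eq_comp_fst (F := fun r => cX φ r - deriv T r.1 * U1 * r.2.1)
    (fun p hp => (contDiffAt_cX (sφ p hp)).sub (((sT1 p hp).mul contDiffAt_const).mul (hx p)))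
    (fun p hp => by
      rw [dX p hp _ rfl, (c p hp).2.2.2.2.2.1, T1 p hp, hU1 p hp]; ring)
    (fun p hp => by rw [dX p hp _ rfl, (c p hp).2.2.2.1]; ring)
  obtain ⟨p₀, hp₀⟩ := dΩ.isConnected.nonempty
  refine ⟨T, X0, U0, U1, sT, sX0, ?_, ?_, ?_⟩
  · rintro _ ⟨p, hp, rfl⟩
    rw [← T1 p hp]
    exact (c p hp).1
  · rw [← hU1 p₀ hp₀]
    exact (c p₀ hp₀).2.2.2.2.1
  · intro p hp
    refine Prod.ext (eT p hp) (Prod.ext ?_ ?_)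
    · exact sub_eq_iff_eq_add'.1 (eX0 p hp)
    · exact sub_eq_iff_eq_add'.1 (hU0 p hp)

/-- The transformation of the arbitrary elements by a transformation of explicit form. -/
theorem ExplicitForm.coeffs_eq {Ω Ω' : Set Space} {φ : Space → Space} {θ θ' : Coeffs}
    {T X0 : ℝ → ℝ} {U0 U1 : ℝ} (hf : ExplicitForm Ω φ T X0 U0 U1)
    (h : MapsEquation Ω φ θ θ') (dΩ : IsDom Ω) (hΩ' : IsOpen Ω') (hφ : IsDiffeo φ Ω Ω')
    (hθ : θ ∈ wholeClass (base '' Ω)) (hθ' : θ' ∈ wholeClass (base '' Ω'))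
    (hreg : ∃ q ∈ base '' Ω, dx (dx θ.A1) q ≠ 0) {p : Space} (hp : p ∈ Ω) :
    (θ'.A1 (base (φ p)), θ'.A2 (base (φ p))) =
      (U1 * θ.A1 (base p) + U0
        - (deriv (deriv T) p.1 * U1 * p.2.1 + deriv X0 p.1) / deriv T p.1,
        deriv T p.1 * U1 ^ 2 * θ.A2 (base p)) := by
  obtain ⟨-, -, -, -, -, -, -, -, -, -, -, e1, e2⟩ := h.components dΩ hΩ' hφ hθ hθ' hreg p hp
  rw [e1, e2, hf.pd_cT dΩ hp, hf.pd_cX dΩ hp, hf.pd_cU dΩ hp,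
    show cU φ p = U1 * p.2.2 + U0 by rw [cU, hf.form p hp]]
  refine Prod.ext ?_ rfl
  simp only
  ring

/-! ### Transformations of explicit form -/

namespace ExplicitForm

variable {Ω : Set Space} {φ : Space → Space} {T X0 : ℝ → ℝ} {U0 U1 : ℝ}

/-- The `t`-projection of a connected set is an interval, so Rolle's theorem applies. -/
lemma injOn_T (h : ExplicitForm Ω φ T X0 U0 U1) (dΩ : IsDom Ω) : InjOn T (Prod.fst '' Ω) := by
  have hoc : (Prod.fst '' Ω).OrdConnected :=
    (dΩ.isConnected.isPreconnected.image _ continuous_fst.continuousOn).ordConnected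
  have key : ∀ a ∈ Prod.fst '' Ω, ∀ b ∈ Prod.fst '' Ω, a < b → T a ≠ T b := by
    intro a ha b hb hab he
    obtain ⟨c, hc, hd⟩ := exists_deriv_eq_zero hab
      (h.smooth_T.continuousOn.mono (hoc.out ha hb)) he
    exact h.deriv_ne c (hoc.out ha hb (Ioo_subset_Icc_self hc)) hd
  intro a ha b hb he
  by_contra hne
  rcases lt_or_gt_of_ne hne with hlt | hlt
  · exact key a ha b hb hlt he
  · exact key b hb a ha hlt he.symm

/-- Near `T t` the set-theoretic inverse provided by injectivity coincides with the smooth local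
inverse of the inverse function theorem. -/
lemma exists_inverse (h : ExplicitForm Ω φ T X0 U0 U1) (dΩ : IsDom Ω) :
    ∃ S : ℝ → ℝ, (∀ t ∈ Prod.fst '' Ω, ContDiffAt ℝ ∞ S (T t) ∧ S (T t) = t) ∧
      IsOpen (T '' (Prod.fst '' Ω)) := by
  have hn : (∞ : WithTop ℕ∞) ≠ 0 := by simp
  have hI := dΩ.isOpen_fst
  have hinj := h.injOn_T dΩ
  have hinv := hinj.leftInvOn_invFunOn
  refine ⟨Function.invFunOn T (Prod.fst '' Ω), fun t ht => ⟨?_, hinv ht⟩, ?_⟩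
  · have hT := h.contDiffAt_T dΩ ht
    have hd : HasFDerivAt T ((ContinuousLinearEquiv.unitsEquivAut ℝ
        (Units.mk0 (deriv T t) (h.deriv_ne t ht)) : ℝ ≃L[ℝ] ℝ) : ℝ →L[ℝ] ℝ) t := by
      refine (diffAt hT).hasDerivAt.hasFDerivAt.congr_fderiv ?_
      ext
      simp
    have hs := hT.hasStrictFDerivAt' hd hn
    refine (hT.to_localInverse hd hn).congr_of_eventuallyEq ?_
    have hc : ContinuousAt (hT.localInverse hd hn) (T t) := (hT.to_localInverse hd hn).continuousAt
    have h0 : hT.localInverse hd hn (T t) = t := hs.localInverse_apply_image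
    rw [ContinuousAt, h0] at hc
    filter_upwards [hs.eventually_right_inverse, hc.eventually (hI.mem_nhds ht)] with y hy hyI
    have e := hinv hyI
    change T (hT.localInverse hd hn y) = y at hy
    rwa [hy] at e
  · refine isOpen_iff_mem_nhds.2 ?_
    rintro _ ⟨t, ht, rfl⟩
    have hT := h.contDiffAt_T dΩ ht
    rw [← (hT.hasStrictDerivAt (by simp)).map_nhds_eq (h.deriv_ne t ht)]
    exact image_mem_map (hI.mem_nhds ht)

/-- The inverse of a transformation of explicit form. -/
noncomputable def inv (S T X0 : ℝ → ℝ) (U0 U1 : ℝ) (z : Space) : Space :=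
  (S z.1, (z.2.1 - X0 (S z.1)) / (deriv T (S z.1) * U1), (z.2.2 - U0) / U1)

lemma inv_apply (h : ExplicitForm Ω φ T X0 U0 U1) {S : ℝ → ℝ}
    (hS : ∀ t ∈ Prod.fst '' Ω, ContDiffAt ℝ ∞ S (T t) ∧ S (T t) = t) {p : Space} (hp : p ∈ Ω) :
    inv S T X0 U0 U1 (φ p) = p := by
  have h1 := h.deriv_ne p.1 ⟨p, hp, rfl⟩
  have h2 := h.U1_ne
  rw [h.form p hp, inv]
  simp only [(hS p.1 ⟨p, hp, rfl⟩).2]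
  refine Prod.ext rfl (Prod.ext ?_ ?_)
  · simp only
    field_simp
    ring
  · simp only
    field_simp
    ring

/-- Nothing is known of `S` outside the range of `T`, whence the separate condition `hz`. -/
lemma apply_inv (h : ExplicitForm Ω φ T X0 U0 U1) {S : ℝ → ℝ}
    (hS : ∀ t ∈ Prod.fst '' Ω, ContDiffAt ℝ ∞ S (T t) ∧ S (T t) = t) {z : Space}
    (hz : z.1 ∈ T '' (Prod.fst '' Ω)) (hi : inv S T X0 U0 U1 z ∈ Ω) :
    φ (inv S T X0 U0 U1 z) = z := by
  obtain ⟨t, ht, htz⟩ := hz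
  have h1 := h.deriv_ne t ht
  have h2 := h.U1_ne
  rw [h.form _ hi]
  have e : S z.1 = t := by rw [← htz]; exact (hS t ht).2
  simp only [inv, e]
  refine Prod.ext htz (Prod.ext ?_ ?_)
  · simp only
    field_simp
    ring
  · simp only
    field_simp
    ring

lemma contDiffAt_inv (h : ExplicitForm Ω φ T X0 U0 U1) (dΩ : IsDom Ω) {S : ℝ → ℝ}
    (hS : ∀ t ∈ Prod.fst '' Ω, ContDiffAt ℝ ∞ S (T t) ∧ S (T t) = t) {z : Space}
    (hz : z.1 ∈ T '' (Prod.fst '' Ω)) :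
    ContDiffAt ℝ ∞ (inv S T X0 U0 U1) z ∧ ContDiffAt ℝ ∞ (fun z : Space => S z.1) z ∧
      S z.1 ∈ Prod.fst '' Ω := by
  obtain ⟨t, ht, htz⟩ := hz
  have hSt := hS t ht
  rw [htz] at hSt
  have hI : S z.1 ∈ Prod.fst '' Ω := by rwa [hSt.2]
  have c1 : ContDiffAt ℝ ∞ (fun z : Space => S z.1) z := contDiffAt_comp_fst hSt.1
  have c2 : ContDiffAt ℝ ∞ (fun z : Space => X0 (S z.1)) z :=
    ContDiffAt.comp z (g := X0) (h.contDiffAt_X0 dΩ hI) c1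
  have c3 : ContDiffAt ℝ ∞ (fun z : Space => deriv T (S z.1)) z :=
    ContDiffAt.comp z (g := deriv T) (contDiffAt_deriv (h.contDiffAt_T dΩ hI)) c1
  have cx : ContDiffAt ℝ ∞ (fun z : Space => z.2.1) z := contDiffAt_fst.comp z contDiffAt_snd
  have cu : ContDiffAt ℝ ∞ (fun z : Space => z.2.2) z := contDiffAt_snd.comp z contDiffAt_snd
  exact ⟨c1.prodMk (((cx.sub c2).div (c3.mul contDiffAt_const)
    (mul_ne_zero (h.deriv_ne _ hI) h.U1_ne)).prodMk
      ((cu.sub contDiffAt_const).div contDiffAt_const h.U1_ne)), c1, hI⟩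

lemma fst_mem (h : ExplicitForm Ω φ T X0 U0 U1) {z : Space} (hz : z ∈ φ '' Ω) :
    z.1 ∈ T '' (Prod.fst '' Ω) := by
  obtain ⟨p, hp, rfl⟩ := hz
  rw [h.form p hp]
  exact ⟨p.1, ⟨p, hp, rfl⟩, rfl⟩

lemma contDiffAt (h : ExplicitForm Ω φ T X0 U0 U1) (dΩ : IsDom Ω) {p : Space} (hp : p ∈ Ω) :
    ContDiffAt ℝ ∞ φ p := by
  have hT := h.contDiffAt_T dΩ ⟨p, hp, rfl⟩
  have cx : ContDiffAt ℝ ∞ (fun z : Space => z.2.1) p := contDiffAt_fst.comp p contDiffAt_snd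
  have cu : ContDiffAt ℝ ∞ (fun z : Space => z.2.2) p := contDiffAt_snd.comp p contDiffAt_snd
  refine ContDiffAt.congr_of_eventuallyEq (f := fun p : Space =>
    (T p.1, deriv T p.1 * U1 * p.2.1 + X0 p.1, U1 * p.2.2 + U0)) ?_
    (Filter.mem_of_superset (dΩ.isOpen.mem_nhds hp) h.form)
  exact (contDiffAt_comp_fst hT).prodMk (((((contDiffAt_comp_fst (contDiffAt_deriv hT)).mul
    contDiffAt_const).mul cx).add (contDiffAt_comp_fst (h.contDiffAt_X0 dΩ ⟨p, hp, rfl⟩))).prodMk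
      ((contDiffAt_const.mul cu).add contDiffAt_const))

lemma isDiffeo (h : ExplicitForm Ω φ T X0 U0 U1) (dΩ : IsDom Ω) : IsDiffeo φ Ω (φ '' Ω) := by
  obtain ⟨S, hS, -⟩ := h.exists_inverse dΩ
  refine ⟨fun p hp => (h.contDiffAt dΩ hp).contDiffWithinAt, mapsTo_image _ _,
    inv S T X0 U0 U1, fun z hz =>
      (h.contDiffAt_inv dΩ hS (h.fst_mem hz)).1.contDiffWithinAt, ?_, ?_, ?_⟩
  · rintro _ ⟨p, hp, rfl⟩
    rwa [h.inv_apply hS hp]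
  · exact fun p hp => h.inv_apply hS hp
  · rintro _ ⟨p, hp, rfl⟩
    rw [h.inv_apply hS hp]

/-- The image is the preimage of `Ω` under the inverse formula over an open set of times, and its
section at `T t` is an affine image of the section of `Ω` at `t`. -/
lemma isDom_image (h : ExplicitForm Ω φ T X0 U0 U1) (dΩ : IsDom Ω) : IsDom (φ '' Ω) := by
  obtain ⟨S, hS, hJ⟩ := h.exists_inverse dΩ
  refine ⟨?_, dΩ.isConnected.image _ fun p hp =>
    (h.contDiffAt dΩ hp).continuousAt.continuousWithinAt, fun s => ?_⟩
  · have e : φ '' Ω = (Prod.fst ⁻¹' (T '' (Prod.fst '' Ω))) ∩ inv S T X0 U0 U1 ⁻¹' Ω := by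
      ext z
      constructor
      · intro hz
        refine ⟨h.fst_mem hz, ?_⟩
        obtain ⟨p, hp, rfl⟩ := hz
        rwa [mem_preimage, h.inv_apply hS hp]
      · rintro ⟨hz, hi⟩
        exact ⟨_, hi, h.apply_inv hS hz hi⟩
    rw [e]
    exact ContinuousOn.isOpen_inter_preimage
      (fun z hz => (h.contDiffAt_inv dΩ hS hz).1.continuousAt.continuousWithinAt)
      (hJ.preimage continuous_fst) dΩ.isOpen
  · by_cases hs : s ∈ T '' (Prod.fst '' Ω)
    · obtain ⟨t, ht, rfl⟩ := hs
      have e : {q : ℝ × ℝ | (T t, q) ∈ φ '' Ω} = (fun q : ℝ × ℝ =>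
          (deriv T t * U1 * q.1 + X0 t, U1 * q.2 + U0)) '' {q : ℝ × ℝ | (t, q) ∈ Ω} := by
        ext q
        constructor
        · rintro ⟨⟨t', q'⟩, hp, he⟩
          rw [h.form _ hp] at he
          simp only [Prod.mk.injEq] at he
          have : t' = t := h.injOn_T dΩ ⟨_, hp, rfl⟩ ht he.1
          subst this
          exact ⟨q', hp, he.2⟩
        · rintro ⟨q', hp, rfl⟩
          exact ⟨(t, q'), hp, h.form _ hp⟩
      rw [e]
      exact (dΩ.slice t).image _ (by fun_prop)
    · have e : {q : ℝ × ℝ | (s, q) ∈ φ '' Ω} = ∅ :=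
        eq_empty_of_forall_notMem fun q hq => hs (h.fst_mem hq)
      rw [e]
      exact isPreconnected_empty

/-- The components for the arbitrary elements in a transformation of explicit form. -/
noncomputable def elem (T X0 : ℝ → ℝ) (U0 U1 : ℝ) (z : Space × (ℝ × ℝ)) : ℝ × ℝ :=
  (U1 * z.2.1 + U0 - (deriv (deriv T) z.1.1 * U1 * z.1.2.1 + deriv X0 z.1.1) / deriv T z.1.1,
    deriv T z.1.1 * U1 ^ 2 * z.2.2)

lemma contDiffAt_shift (h : ExplicitForm Ω φ T X0 U0 U1) (dΩ : IsDom Ω) {p : Space} (hp : p ∈ Ω) :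
    ContDiffAt ℝ ∞ (fun r : Space =>
      (deriv (deriv T) r.1 * U1 * r.2.1 + deriv X0 r.1) / deriv T r.1) p := by
  have hT := contDiffAt_deriv (h.contDiffAt_T dΩ ⟨p, hp, rfl⟩)
  have cx : ContDiffAt ℝ ∞ (fun z : Space => z.2.1) p := contDiffAt_fst.comp p contDiffAt_snd
  exact ((((contDiffAt_comp_fst (contDiffAt_deriv hT)).mul contDiffAt_const).mul cx).add
    (contDiffAt_comp_fst (contDiffAt_deriv (h.contDiffAt_X0 dΩ ⟨p, hp, rfl⟩)))).div
    (contDiffAt_comp_fst hT) (h.deriv_ne _ ⟨p, hp, rfl⟩)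

lemma isDiffeo_total (h : ExplicitForm Ω φ T X0 U0 U1) (dΩ : IsDom Ω) :
    IsDiffeo (fun z : Space × (ℝ × ℝ) => (φ z.1, elem T X0 U0 U1 z)) (totalSet Ω)
      (totalSet (φ '' Ω)) := by
  obtain ⟨S, hS, -⟩ := h.exists_inverse dΩ
  have hU := h.U1_ne
  have hT : ∀ p ∈ Ω, deriv T p.1 ≠ 0 := fun p hp => h.deriv_ne _ ⟨p, hp, rfl⟩
  have cT1 : ∀ p ∈ Ω, ContDiffAt ℝ ∞ (fun r : Space => deriv T r.1) p := fun p hp =>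
    contDiffAt_comp_fst (contDiffAt_deriv (h.contDiffAt_T dΩ ⟨p, hp, rfl⟩))
  have c1 : ∀ z : Space × (ℝ × ℝ), ContDiffAt ℝ ∞ (fun z : Space × (ℝ × ℝ) => z.2.1) z :=
    fun z => contDiffAt_fst.comp z contDiffAt_snd
  have c2 : ∀ z : Space × (ℝ × ℝ), ContDiffAt ℝ ∞ (fun z : Space × (ℝ × ℝ) => z.2.2) z :=
    fun z => contDiffAt_snd.comp z contDiffAt_snd
  refine ⟨fun z hz => ?_, fun z hz => ⟨mem_image_of_mem _ hz.1, ?_⟩,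
    fun z => (inv S T X0 U0 U1 z.1,
      (z.2.1 - U0 + (deriv (deriv T) (inv S T X0 U0 U1 z.1).1 * U1 * (inv S T X0 U0 U1 z.1).2.1
        + deriv X0 (inv S T X0 U0 U1 z.1).1) / deriv T (inv S T X0 U0 U1 z.1).1) / U1,
      z.2.2 / (deriv T (inv S T X0 U0 U1 z.1).1 * U1 ^ 2)), ?_, ?_, ?_, ?_⟩
  · have e1 : ContDiffAt ℝ ∞ (fun z : Space × (ℝ × ℝ) => φ z.1) z :=
      ContDiffAt.comp z (g := φ) (h.contDiffAt dΩ hz.1) contDiffAt_fst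
    have e2 : ContDiffAt ℝ ∞ (fun z : Space × (ℝ × ℝ) =>
        (deriv (deriv T) z.1.1 * U1 * z.1.2.1 + deriv X0 z.1.1) / deriv T z.1.1) z :=
      ContDiffAt.comp z (h.contDiffAt_shift dΩ hz.1) contDiffAt_fst
    have e3 : ContDiffAt ℝ ∞ (fun z : Space × (ℝ × ℝ) => deriv T z.1.1) z :=
      ContDiffAt.comp z (cT1 _ hz.1) contDiffAt_fst
    exact (e1.prodMk ((((contDiffAt_const.mul (c1 z)).add contDiffAt_const).sub e2).prodMk
      ((e3.mul contDiffAt_const).mul (c2 z)))).contDiffWithinAt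
  · exact mul_ne_zero (mul_ne_zero (hT _ hz.1) (pow_ne_zero 2 hU)) hz.2
  · rintro ⟨_, b⟩ ⟨⟨p, hp, rfl⟩, hb⟩
    have ei : ContDiffAt ℝ ∞ (fun z : Space × (ℝ × ℝ) => inv S T X0 U0 U1 z.1) (φ p, b) :=
      ContDiffAt.comp (φ p, b) (g := inv S T X0 U0 U1)
        (h.contDiffAt_inv dΩ hS (h.fst_mem ⟨p, hp, rfl⟩)).1 contDiffAt_fst
    have hm : inv S T X0 U0 U1 (φ p) ∈ Ω := by rwa [h.inv_apply hS hp]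
    have e2 := ContDiffAt.comp (φ p, b) (h.contDiffAt_shift dΩ hm) ei
    have e3 := ContDiffAt.comp (φ p, b) (cT1 _ hm) ei
    exact (ei.prodMk (((((c1 _).sub contDiffAt_const).add e2).div contDiffAt_const hU).prodMk
      ((c2 _).div (e3.mul contDiffAt_const)
        (mul_ne_zero (hT _ hm) (pow_ne_zero 2 hU))))).contDiffWithinAt
  · rintro ⟨_, b⟩ ⟨⟨p, hp, rfl⟩, hb⟩
    simp only [h.inv_apply hS hp]
    exact ⟨hp, div_ne_zero hb (mul_ne_zero (hT _ hp) (pow_ne_zero 2 hU))⟩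
  · rintro ⟨p, a⟩ ⟨hp, ha⟩
    have := hT p hp
    simp only [h.inv_apply hS hp, elem]
    refine Prod.ext rfl (Prod.ext ?_ ?_)
    · simp only
      field_simp
      ring
    · simp only
      field_simp
  · rintro ⟨_, b⟩ ⟨⟨p, hp, rfl⟩, hb⟩
    have := hT p hp
    simp only [h.inv_apply hS hp, elem]
    refine Prod.ext rfl (Prod.ext ?_ ?_)
    · simp only
      field_simp
      ring
    · simp only
      field_simp

end ExplicitForm

/-! ### Action of explicit transformations on equations and coefficients -/

namespace ExplicitForm

variable {Ω : Set Space} {φ : Space → Space} {T X0 : ℝ → ℝ} {U0 U1 : ℝ}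

/-- The `x`-component of a transformation of explicit form as a function of `(t, x)`. -/
noncomputable def xMap (T X0 : ℝ → ℝ) (U1 : ℝ) (r : Plane) : ℝ := deriv T r.1 * U1 * r.2 + X0 r.1

lemma base_apply (h : ExplicitForm Ω φ T X0 U0 U1) {p : Space} (hp : p ∈ Ω) :
    base (φ p) = (T (base p).1, xMap T X0 U1 (base p)) := by
  rw [h.form p hp]
  rfl

lemma pd_comp_plane_fst {g : ℝ → ℝ} {q : Plane} (hg : DifferentiableAt ℝ g q.1) (v : Plane) :
    pd v (fun r : Plane => g r.1) q = v.1 * deriv g q.1 := by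
  have h := hg.hasDerivAt.comp_hasFDerivAt q (hasFDerivAt_fst (𝕜 := ℝ) (p := q))
  have h' : HasFDerivAt (fun r : Plane => g r.1) _ q := h
  rw [pd, h'.fderiv]
  simp [mul_comm]

lemma contDiffAt_comp_plane_fst {g : ℝ → ℝ} {q : Plane} (h : ContDiffAt ℝ ∞ g q.1) :
    ContDiffAt ℝ ∞ (fun r : Plane => g r.1) q :=
  ContDiffAt.comp q (g := g) h contDiffAt_fst

lemma contDiffAt_xMap (h : ExplicitForm Ω φ T X0 U0 U1) (dΩ : IsDom Ω) {q : Plane}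
    (hq : q.1 ∈ Prod.fst '' Ω) : ContDiffAt ℝ ∞ (xMap T X0 U1) q :=
  (((contDiffAt_comp_plane_fst (contDiffAt_deriv (h.contDiffAt_T dΩ hq))).mul
    contDiffAt_const).mul contDiffAt_snd).add (contDiffAt_comp_plane_fst (h.contDiffAt_X0 dΩ hq))

lemma pd_xMap (h : ExplicitForm Ω φ T X0 U0 U1) (dΩ : IsDom Ω) {q : Plane}
    (hq : q.1 ∈ Prod.fst '' Ω) (v : Plane) : pd v (xMap T X0 U1) q =
      v.1 * (deriv (deriv T) q.1 * U1 * q.2 + deriv X0 q.1) + v.2 * (deriv T q.1 * U1) := by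
  have hT := contDiffAt_deriv (h.contDiffAt_T dΩ hq)
  have hX := h.contDiffAt_X0 dΩ hq
  have hT' := contDiffAt_comp_plane_fst hT
  have e : xMap T X0 U1 = fun r : Plane => deriv T r.1 * U1 * r.2 + X0 r.1 := rfl
  rw [e, pd_add ((hT'.mul contDiffAt_const).mul contDiffAt_snd) (contDiffAt_comp_plane_fst hX),
    pd_mul (hT'.mul contDiffAt_const) contDiffAt_snd, pd_mul hT' contDiffAt_const, pd_const,
    pd_comp_plane_fst (diffAt hT), pd_comp_plane_fst (diffAt hX)]
  have e2 : pd v (fun r : Plane => r.2) q = v.2 := pd_snd v q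
  rw [e2]
  ring

/-- The chain rule for the change of the independent variables. -/
lemma pd_comp (h : ExplicitForm Ω φ T X0 U0 U1) (dΩ : IsDom Ω) {q : Plane}
    (hq : q.1 ∈ Prod.fst '' Ω) {f : Plane → ℝ}
    (hf : DifferentiableAt ℝ f (T q.1, xMap T X0 U1 q)) :
    pd (1, 0) (fun r => f (T r.1, xMap T X0 U1 r)) q
        = dt f (T q.1, xMap T X0 U1 q) * deriv T q.1
          + dx f (T q.1, xMap T X0 U1 q) * (deriv (deriv T) q.1 * U1 * q.2 + deriv X0 q.1) ∧
      pd (0, 1) (fun r => f (T r.1, xMap T X0 U1 r)) q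
        = dx f (T q.1, xMap T X0 U1 q) * (deriv T q.1 * U1) := by
  have hT := h.contDiffAt_T dΩ hq
  have hT' := diffAt (contDiffAt_comp_plane_fst hT)
  have hX := diffAt (h.contDiffAt_xMap dΩ hq)
  rw [pd_comp_pair (a := fun r => T r.1) hf hT' hX, pd_comp_pair (a := fun r => T r.1) hf hT' hX,
    pd_comp_plane_fst (diffAt hT), pd_comp_plane_fst (diffAt hT), h.pd_xMap dΩ hq,
    h.pd_xMap dΩ hq]
  exact ⟨by rw [dt_eq_pd, dx_eq_pd]; ring, by rw [dx_eq_pd]; ring⟩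

/-- At fixed `t` the new `x̃` is affine in `x`, so no first derivatives of `f` appear. -/
lemma pd_pd_comp (h : ExplicitForm Ω φ T X0 U0 U1) (dΩ : IsDom Ω) {q : Plane}
    (hq : q.1 ∈ Prod.fst '' Ω) {f : Plane → ℝ}
    (hf : ContDiffAt ℝ ∞ f (T q.1, xMap T X0 U1 q)) :
    pd (0, 1) (pd (0, 1) (fun r => f (T r.1, xMap T X0 U1 r))) q
      = dx (dx f) (T q.1, xMap T X0 U1 q) * (deriv T q.1 * U1) ^ 2 := by
  have hT := h.contDiffAt_T dΩ hq
  have hT1 := contDiffAt_deriv hT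
  have hB : ContDiffAt ℝ ∞ (fun r : Plane => (T r.1, xMap T X0 U1 r)) q :=
    (contDiffAt_comp_plane_fst hT).prodMk (h.contDiffAt_xMap dΩ hq)
  have ev : ∀ᶠ r in 𝓝 q, pd (0, 1) (fun r => f (T r.1, xMap T X0 U1 r)) r
      = dx f (T r.1, xMap T X0 U1 r) * (deriv T r.1 * U1) := by
    filter_upwards [hB.continuousAt.eventually (eventually_diffAt hf),
      continuousAt_fst.eventually (dΩ.isOpen_fst.mem_nhds hq)] with r h1 h2
    exact (h.pd_comp dΩ h2 h1).2
  have hd : ContDiffAt ℝ ∞ (dx f) (T q.1, xMap T X0 U1 q) := contDiffAt_pd hf _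
  have hc : ContDiffAt ℝ ∞ (fun r => dx f (T r.1, xMap T X0 U1 r)) q :=
    ContDiffAt.comp q (g := dx f) hd hB
  rw [pd_congr_nhds ev, pd_mul hc
    ((contDiffAt_comp_plane_fst hT1).mul contDiffAt_const),
    pd_mul (contDiffAt_comp_plane_fst hT1) contDiffAt_const, pd_const,
    pd_comp_plane_fst (diffAt hT1), (h.pd_comp dΩ hq (diffAt hd)).2]
  ring

/-- A transformation of explicit form maps each equation to the one with the transformed
coefficients. -/
theorem mapsEquation (h : ExplicitForm Ω φ T X0 U0 U1) (dΩ : IsDom Ω) {θ θ' : Coeffs}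
    (hc : ∀ p ∈ Ω, (θ'.A1 (base (φ p)), θ'.A2 (base (φ p)))
      = elem T X0 U0 U1 (p, (θ.A1 (base p), θ.A2 (base p)))) :
    MapsEquation Ω φ θ θ' := by
  intro q f f' G hf hp _ hf' hG
  have hq : q.1 ∈ Prod.fst '' Ω := ⟨_, hp, rfl⟩
  have hcont : ContinuousAt (fun r : Plane => (r.1, r.2, f r)) q :=
    continuousAt_fst.prodMk (continuousAt_snd.prodMk hf.continuousAt)
  have hev : ∀ᶠ r in 𝓝 q, f' (T r.1, xMap T X0 U1 r) = U1 * f r + U0 := by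
    filter_upwards [hG, hcont.eventually (dΩ.isOpen.mem_nhds hp)] with r h1 h2
    have e1 : base (G r) = (T r.1, xMap T X0 U1 r) := h.base_apply h2
    have e2 : (G r).2.2 = U1 * f r + U0 := by
      change (φ (r.1, r.2, f r)).2.2 = _
      rw [h.form _ h2]
    rw [e1, e2] at h1
    exact h1
  have eb : base (G q) = (T q.1, xMap T X0 U1 q) := h.base_apply hp
  have hcq := hc _ hp
  have eb' : base (φ (q.1, q.2, f q)) = (T q.1, xMap T X0 U1 q) := eb
  rw [eb', elem] at hcq
  simp only [Prod.mk.injEq] at hcq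
  have ebase : base (q.1, q.2, f q) = q := rfl
  rw [ebase] at hcq
  rw [eb] at hf' ⊢
  have w1 : ∀ v : Plane, ∀ᶠ r in 𝓝 q, pd v (fun r => f' (T r.1, xMap T X0 U1 r)) r
      = U1 * pd v f r := fun v => by
    filter_upwards [hev.eventually_nhds, eventually_diffAt hf] with r h1 h2
    rw [pd_congr_nhds h1]
    have := ((h2.hasFDerivAt.const_mul U1).add_const U0).fderiv
    simp [pd, this]
  have d1 := (w1 (1, 0)).self_of_nhds
  have d2 := (w1 (0, 1)).self_of_nhds
  have d3 := pd_congr_nhds (w1 (0, 1)) (0, 1)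
  rw [(h.pd_comp dΩ hq (diffAt hf')).1, ← dt_eq_pd] at d1
  rw [(h.pd_comp dΩ hq (diffAt hf')).2, ← dx_eq_pd] at d2
  rw [h.pd_pd_comp dΩ hq hf', pd_const_mul (contDiffAt_pd hf _), ← dx_eq_pd, ← dx_eq_pd] at d3
  have hT := h.deriv_ne _ hq
  have hU := h.U1_ne
  -- The term `x̃_t f'_x̃` of the chain rule and the shift `U⁰` of the unknown function are
  -- cancelled by the inhomogeneous part of `Ã¹`.
  have key : deriv T q.1 * residual θ' f' (T q.1, xMap T X0 U1 q) = U1 * residual θ f q := by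
    have d2' : dx f' (T q.1, xMap T X0 U1 q) * deriv T q.1 = dx f q :=
      mul_left_cancel₀ hU (by linear_combination d2)
    have d3' : dx (dx f') (T q.1, xMap T X0 U1 q) * (deriv T q.1 ^ 2 * U1) = dx (dx f) q :=
      mul_left_cancel₀ hU (by linear_combination d3)
    rw [residual, residual, hcq.1, hcq.2, hev.self_of_nhds, ← d2', ← d3']
    field_simp
    linear_combination d1
  constructor
  · intro h0
    rw [h0, mul_zero] at key
    exact (mul_eq_zero.1 key).resolve_left hT
  · intro h0
    rw [h0, mul_zero] at key
    exact (mul_eq_zero.1 key.symm).resolve_left hU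

/-- The transformed coefficients. -/
theorem exists_coeffs (h : ExplicitForm Ω φ T X0 U0 U1) (dΩ : IsDom Ω) {θ : Coeffs}
    (hθ : θ ∈ wholeClass (base '' Ω)) :
    ∃ θ' ∈ wholeClass (base '' (φ '' Ω)),
      (∀ p ∈ Ω, (θ'.A1 (base (φ p)), θ'.A2 (base (φ p)))
        = elem T X0 U0 U1 (p, (θ.A1 (base p), θ.A2 (base p)))) ∧
      ∀ p ∈ Ω, dx (dx θ'.A1) (base (φ p)) ≠ 0 ↔ dx (dx θ.A1) (base p) ≠ 0 := by
  obtain ⟨S, hS, -⟩ := h.exists_inverse dΩ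
  -- The `(t, x)`-part of the inverse does not involve `ũ`, so any value, here `0`, may be inserted.
  -- The lifted point need not lie in the image of `Ω`; smoothness of the inverse needs only its
  -- time to lie in the range of `T`.
  let lift : Plane → Space := fun z => (z.1, z.2, 0)
  have hlift : ContDiff ℝ ∞ lift := contDiff_fst.prodMk (contDiff_snd.prodMk contDiff_const)
  let J : Plane → Space := fun z => inv S T X0 U0 U1 (lift z)
  let E : Plane → ℝ × ℝ := fun z =>
    elem T X0 U0 U1 (J z, (θ.A1 (base (J z)), θ.A2 (base (J z))))
  have hJ : ∀ p ∈ Ω, base (J (base (φ p))) = base p := fun p hp => by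
    have e := congrArg base (h.inv_apply hS hp)
    exact e
  have hEq : ∀ p ∈ Ω, E (base (φ p)) = elem T X0 U0 U1 (p, (θ.A1 (base p), θ.A2 (base p))) := by
    intro p hp
    have e1 : (J (base (φ p))).1 = p.1 := by
      have e := congrArg Prod.fst (hJ p hp)
      exact e
    have e2 : (J (base (φ p))).2.1 = p.2.1 := by
      have e := congrArg Prod.snd (hJ p hp)
      exact e
    simp only [E, elem, hJ p hp, e1, e2]
  have sA : ∀ p ∈ Ω, ContDiffAt ℝ ∞ E (base (φ p)) := by
    intro p hp
    have hz := h.fst_mem (mem_image_of_mem φ hp)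
    have sJ : ContDiffAt ℝ ∞ J (base (φ p)) :=
      ContDiffAt.comp _ (h.contDiffAt_inv dΩ hS (z := lift (base (φ p))) hz).1 hlift.contDiffAt
    have hmem : base (J (base (φ p))) ∈ base '' Ω := by
      rw [hJ p hp]; exact mem_image_of_mem _ hp
    have hD := (isOpenMap_base _ dΩ.isOpen).mem_nhds hmem
    have sbJ : ContDiffAt ℝ ∞ (fun z => base (J z)) (base (φ p)) :=
      contDiff_base.contDiffAt.comp _ sJ
    have s1 := ContDiffAt.comp (base (φ p)) (hθ.1.contDiffAt hD) sbJ
    have s2 := ContDiffAt.comp (base (φ p)) (hθ.2.1.contDiffAt hD) sbJ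
    have hI : (J (base (φ p))).1 ∈ Prod.fst '' Ω := by
      have e := congrArg Prod.fst (hJ p hp)
      rw [show (J (base (φ p))).1 = p.1 from e]
      exact ⟨p, hp, rfl⟩
    have t1 := contDiffAt_deriv (h.contDiffAt_T dΩ hI)
    have x1 := contDiffAt_deriv (h.contDiffAt_X0 dΩ hI)
    have sJ1 : ContDiffAt ℝ ∞ (fun z => (J z).1) (base (φ p)) := contDiffAt_fst.comp _ sJ
    have sJ2 : ContDiffAt ℝ ∞ (fun z => (J z).2.1) (base (φ p)) :=
      contDiffAt_fst.comp _ (contDiffAt_snd.comp _ sJ)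
    have cT1 := ContDiffAt.comp (base (φ p)) t1 sJ1
    have cT2 := ContDiffAt.comp (base (φ p)) (contDiffAt_deriv t1) sJ1
    have cX1 := ContDiffAt.comp (base (φ p)) x1 sJ1
    exact (((contDiffAt_const.mul s1).add contDiffAt_const).sub
      ((((cT2.mul contDiffAt_const).mul sJ2).add cX1).div cT1 (h.deriv_ne _ hI))).prodMk
      ((cT1.mul contDiffAt_const).mul s2)
  refine ⟨⟨fun z => (E z).1, fun z => (E z).2⟩, ⟨?_, ?_, ?_⟩, hEq, fun p hp => ?_⟩
  · rintro _ ⟨_, ⟨p, hp, rfl⟩, rfl⟩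
    exact (contDiffAt_fst.comp _ (sA p hp)).contDiffWithinAt
  · rintro _ ⟨_, ⟨p, hp, rfl⟩, rfl⟩
    exact (contDiffAt_snd.comp _ (sA p hp)).contDiffWithinAt
  · rintro _ ⟨_, ⟨p, hp, rfl⟩, rfl⟩
    simp only [hEq p hp]
    exact mul_ne_zero (mul_ne_zero (h.deriv_ne _ ⟨p, hp, rfl⟩) (pow_ne_zero 2 h.U1_ne))
      (hθ.2.2 _ (mem_image_of_mem _ hp))
  · have hq : (base p).1 ∈ Prod.fst '' Ω := ⟨p, hp, rfl⟩
    have hD := isOpenMap_base _ dΩ.isOpen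
    have s1 : ContDiffAt ℝ ∞ (fun z => (E z).1) (T (base p).1, xMap T X0 U1 (base p)) := by
      rw [← h.base_apply hp]
      exact contDiffAt_fst.comp _ (sA p hp)
    have e := h.pd_pd_comp dΩ hq s1
    have ev : ∀ r ∈ base '' Ω, (E (T r.1, xMap T X0 U1 r)).1 = U1 * θ.A1 r + U0
        - (deriv (deriv T) r.1 * U1 * r.2 + deriv X0 r.1) / deriv T r.1 := by
      rintro _ ⟨p', hp', rfl⟩
      rw [← h.base_apply hp', hEq p' hp']
      rfl
    have ev1 : ∀ r ∈ base '' Ω, pd (0, 1) (fun r => (E (T r.1, xMap T X0 U1 r)).1) r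
        = U1 * dx θ.A1 r - deriv (deriv T) r.1 * U1 / deriv T r.1 := by
      intro r hr
      rw [pd_congr hD ev _ r hr]
      have hI : r.1 ∈ Prod.fst '' Ω := by
        obtain ⟨p', hp', rfl⟩ := hr
        exact ⟨p', hp', rfl⟩
      have sA1 : ContDiffAt ℝ ∞ θ.A1 r := hθ.1.contDiffAt (hD.mem_nhds hr)
      have t0 := h.contDiffAt_T dΩ hI
      have t1 := contDiffAt_deriv t0
      have t2 := contDiffAt_deriv t1
      have x1 := contDiffAt_deriv (h.contDiffAt_X0 dΩ hI)
      have tinv : ContDiffAt ℝ ∞ (fun t => (deriv T t)⁻¹) r.1 := t1.inv (h.deriv_ne _ hI)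
      have g1 : ContDiffAt ℝ ∞ (fun t => deriv (deriv T) t * U1 * (deriv T t)⁻¹) r.1 :=
        (t2.mul contDiffAt_const).mul tinv
      have g2 : ContDiffAt ℝ ∞ (fun t => deriv X0 t * (deriv T t)⁻¹) r.1 := x1.mul tinv
      have G1 := contDiffAt_comp_plane_fst g1
      have G2 := contDiffAt_comp_plane_fst g2
      have e0 : (fun r : Plane => U1 * θ.A1 r + U0
          - (deriv (deriv T) r.1 * U1 * r.2 + deriv X0 r.1) / deriv T r.1)
          = fun r : Plane => U1 * θ.A1 r + U0
            - (deriv (deriv T) r.1 * U1 * (deriv T r.1)⁻¹ * r.2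
              + deriv X0 r.1 * (deriv T r.1)⁻¹) := by
        ext r
        ring
      have e2 : pd (0, 1) (fun r : Plane => r.2) r = 1 := pd_snd _ r
      rw [e0, pd_sub ((contDiffAt_const.mul sA1).add contDiffAt_const)
        ((G1.mul contDiffAt_snd).add G2), pd_add (contDiffAt_const.mul sA1) contDiffAt_const,
        pd_add (G1.mul contDiffAt_snd) G2, pd_mul G1 contDiffAt_snd, pd_const_mul sA1, pd_const,
        pd_comp_plane_fst (diffAt g1), pd_comp_plane_fst (diffAt g2), e2, dx_eq_pd]
      ring
    have hr := mem_image_of_mem base hp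
    have sA1 : ContDiffAt ℝ ∞ (dx θ.A1) (base p) :=
      contDiffAt_pd (hθ.1.contDiffAt (hD.mem_nhds hr)) _
    have t1 := contDiffAt_deriv (h.contDiffAt_T dΩ hq)
    have g1 : ContDiffAt ℝ ∞ (fun t => deriv (deriv T) t * U1 / deriv T t) (base p).1 :=
      ((contDiffAt_deriv t1).mul contDiffAt_const).div t1 (h.deriv_ne _ hq)
    -- The inhomogeneous part of `Ã¹` is affine in `x` and drops out, leaving `Ã¹_xx (T_t U¹)² = U¹
    -- A¹_xx`.
    rw [pd_congr hD ev1 _ _ hr, pd_sub (contDiffAt_const.mul sA1) (contDiffAt_comp_plane_fst g1),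
      pd_const_mul sA1, pd_comp_plane_fst (diffAt g1), zero_mul, sub_zero, ← dx_eq_pd,
      ← h.base_apply hp] at e
    have hT := h.deriv_ne _ hq
    have hU := h.U1_ne
    constructor
    · intro hne h0
      rw [h0, mul_zero] at e
      exact mul_ne_zero hne (pow_ne_zero 2 (mul_ne_zero hT hU)) e.symm
    · intro hne h0
      change dx (dx fun z => (E z).1) _ = 0 at h0
      rw [h0, zero_mul] at e
      exact mul_ne_zero hU hne e

end ExplicitForm

/-! ### Equivalence groups and normalization -/

lemma IsDiffeo.image_eq {E F : Type*} [NormedAddCommGroup E] [NormedSpace ℝ E]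
    [NormedAddCommGroup F] [NormedSpace ℝ F] {f : E → F} {S : Set E} {S' : Set F}
    (h : IsDiffeo f S S') : f '' S = S' := by
  obtain ⟨-, hm, g, -, gm, hi⟩ := h
  exact Subset.antisymm hm.image_subset fun z hz => ⟨g z, gm hz, hi.2 hz⟩

lemma IsDiffeo.congr {E F : Type*} [NormedAddCommGroup E] [NormedSpace ℝ E]
    [NormedAddCommGroup F] [NormedSpace ℝ F] {f f' : E → F} {S : Set E} {S' : Set F}
    (h : IsDiffeo f S S') (he : EqOn f' f S) : IsDiffeo f' S S' := by
  obtain ⟨hs, hm, g, gs, gm, hl, hr⟩ := h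
  refine ⟨hs.congr he, hm.congr he.symm, g, gs, gm, fun p hp => ?_, fun z hz => ?_⟩
  · rw [he hp]; exact hl hp
  · rw [he (gm hz)]; exact hr hz

lemma mem_explicitGroup_iff {Φ : Transf} : Φ ∈ explicitGroup ↔
    IsDom Φ.source ∧ Φ.target = Φ.pt '' Φ.source ∧ ∃ (T X0 : ℝ → ℝ) (U0 U1 : ℝ),
      ExplicitForm Φ.source Φ.pt T X0 U0 U1 ∧
      ∀ z ∈ totalSet Φ.source, Φ.el z = ExplicitForm.elem T X0 U0 U1 z := by
  constructor
  · rintro ⟨h1, h2, T, X0, U0, U1, sT, sX, hT, hU, h⟩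
    exact ⟨h1, h2, T, X0, U0, U1, ⟨sT, sX, hT, hU, fun p hp => (h _ _ _ hp).1⟩,
      fun z hz => (h _ _ _ hz.1).2 _ _ hz.2⟩
  · rintro ⟨h1, h2, T, X0, U0, U1, hf, h⟩
    exact ⟨h1, h2, T, X0, U0, U1, hf.smooth_T, hf.smooth_X0, hf.deriv_ne, hf.U1_ne,
      fun t x u hp => ⟨hf.form _ hp, fun a1 a2 ha => h ((t, x, u), (a1, a2)) ⟨hp, ha⟩⟩⟩

/-- Coefficients with `A¹_xx = 2` that take prescribed values at points with a given `x`. -/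
noncomputable def quadCoeffs (x a1 a2 : ℝ) : Coeffs := ⟨jetPoly 0 x a1 0 0 2 0, fun _ => a2⟩

lemma quadCoeffs_mem (x a1 : ℝ) {a2 : ℝ} (h : a2 ≠ 0) (D : Set Plane) :
    quadCoeffs x a1 a2 ∈ strictlyRegularClass D := by
  refine ⟨⟨(contDiff_jetPoly ..).contDiffOn, contDiffOn_const, fun _ _ => h⟩, fun q _ => ?_⟩
  rw [quadCoeffs, dx_eq_pd, dx_eq_pd, pd_pd_jetPoly]
  norm_num

/-- Rigidity needs regularity of the source equation only, the target being just in the whole class.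
It is therefore enough that `C` lies between the strictly regular and the whole class, which covers
all three cases. -/
theorem usualEquivGroup_subset_explicitGroup {C : EqClass} (hw : ∀ D, C D ⊆ wholeClass D)
    (hs : ∀ D, D.Nonempty → strictlyRegularClass D ⊆ C D) : usualEquivGroup C ⊆ explicitGroup := by
  rintro Φ ⟨d, d', hφ, -, hmap⟩
  obtain ⟨p₀, hp₀⟩ := d.isConnected.nonempty
  have reg : ∀ (x a1 : ℝ) {a2 : ℝ}, a2 ≠ 0 →
      ∃ q ∈ base '' Φ.source, dx (dx (quadCoeffs x a1 a2).A1) q ≠ 0 := fun x a1 a2 h =>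
    ⟨base p₀, mem_image_of_mem _ hp₀,
      (quadCoeffs_mem x a1 h (base '' Φ.source)).2 _ (mem_image_of_mem _ hp₀)⟩
  have mem : ∀ (x a1 : ℝ) {a2 : ℝ}, a2 ≠ 0 → quadCoeffs x a1 a2 ∈ C (base '' Φ.source) :=
    fun x a1 a2 h => hs _ (d.isConnected.nonempty.image _) (quadCoeffs_mem x a1 h _)
  obtain ⟨θ₀, hθ₀, -, hm₀⟩ := hmap _ (mem 0 0 one_ne_zero)
  obtain ⟨T, X0, U0, U1, hf⟩ := hm₀.exists_explicitForm d d'.isOpen hφ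
    (hw _ (mem 0 0 one_ne_zero)) (hw _ hθ₀) (reg 0 0 one_ne_zero)
  refine mem_explicitGroup_iff.2 ⟨d, hφ.image_eq.symm, T, X0, U0, U1, hf, ?_⟩
  rintro ⟨p, a1, a2⟩ ⟨hp, ha⟩
  -- For each point and each pair `(a1, a2)` a different test equation attains these values there.
  -- The parameters `T`, `X0`, `U0`, `U1` depend on the point part only, so those found from the
  -- first test equation serve for all.
  obtain ⟨θ', hθ', hc, hm⟩ := hmap _ (mem p.2.1 a1 ha)
  have e1 := hc p hp
  have e2 := hf.coeffs_eq hm d d'.isOpen hφ (hw _ (mem p.2.1 a1 ha)) (hw _ hθ')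
    (reg p.2.1 a1 ha) hp
  have e3 : (quadCoeffs p.2.1 a1 a2).A1 (base p) = a1 := by simp [quadCoeffs, jetPoly, base]
  have e4 : (quadCoeffs p.2.1 a1 a2).A2 (base p) = a2 := rfl
  rw [e3, e4] at e1 e2
  exact e1.symm.trans e2

/-- The hypothesis `hC` isolates what distinguishes the classes: membership must be inherited when
`A¹_xx` and `Ã¹_xx` vanish at corresponding points. -/
theorem explicitGroup_subset_usualEquivGroup {C : EqClass} (hw : ∀ D, C D ⊆ wholeClass D)
    (hC : ∀ (Ω : Set Space) (φ : Space → Space) (θ θ' : Coeffs), θ ∈ C (base '' Ω) →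
      θ' ∈ wholeClass (base '' (φ '' Ω)) →
      (∀ p ∈ Ω, dx (dx θ'.A1) (base (φ p)) ≠ 0 ↔ dx (dx θ.A1) (base p) ≠ 0) →
      θ' ∈ C (base '' (φ '' Ω))) : explicitGroup ⊆ usualEquivGroup C := by
  intro Φ hΦ
  obtain ⟨d, ht, T, X0, U0, U1, hf, hel⟩ := mem_explicitGroup_iff.1 hΦ
  refine ⟨d, ?_, ?_, ?_, fun θ hθ => ?_⟩
  · rw [ht]; exact hf.isDom_image d
  · rw [ht]; exact hf.isDiffeo d
  · rw [ht]
    exact (hf.isDiffeo_total d).congr fun z hz => Prod.ext rfl (hel z hz)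
  · obtain ⟨θ', hθ', hc, hreg⟩ := hf.exists_coeffs d (hw _ hθ)
    rw [ht]
    refine ⟨θ', hC _ _ θ θ' hθ hθ' hreg, fun p hp => ?_, hf.mapsEquation d hc⟩
    rw [hc p hp]
    exact (hel _ ⟨hp, (hw _ hθ).2.2 _ (mem_image_of_mem _ hp)⟩).symm

/-- An admissible transformation has the explicit form because its source is regular, and its
coefficients transform by the group formula, so it is induced by a group element. In the converse
direction `θ'` is known only through its values on the target, hence the invariance of `C` under
change of coefficients off the domain. -/
theorem isNormalizedUsual_of_eq_explicitGroup {C : EqClass} (hr : ∀ D, D.Nonempty → C D ⊆ regularClass D)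
    (hC : ∀ (D : Set Plane) (θ θ' : Coeffs), IsOpen D → θ ∈ C D →
      (∀ q ∈ D, θ'.A1 q = θ.A1 q) → (∀ q ∈ D, θ'.A2 q = θ.A2 q) → θ' ∈ C D)
    (hG : usualEquivGroup C = explicitGroup) : IsNormalizedUsual C := by
  intro Ω Ω' θ φ θ'
  constructor
  · rintro ⟨d, d', hφ, hθ, hθ', hm⟩
    have r := hr _ (d.isConnected.nonempty.image _) hθ
    have w := r.1
    have w' := (hr _ (d'.isConnected.nonempty.image _) hθ').1
    obtain ⟨T, X0, U0, U1, hf⟩ := hm.exists_explicitForm d d'.isOpen hφ w w' r.2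
    refine ⟨hθ, ⟨Ω, Ω', φ, ExplicitForm.elem T X0 U0 U1⟩, ?_, rfl, rfl, fun _ _ => rfl,
      fun p hp => hf.coeffs_eq hm d d'.isOpen hφ w w' r.2 hp⟩
    rw [hG]
    exact mem_explicitGroup_iff.2 ⟨d, hφ.image_eq.symm, T, X0, U0, U1, hf, fun _ _ => rfl⟩
  · rintro ⟨hθ, Φ, hΦ, rfl, rfl, he, hc⟩
    have hΦ' := hΦ
    rw [hG] at hΦ'
    obtain ⟨d, d', hφ, -, hmap⟩ := hΦ
    obtain ⟨θ'', hθ'', hc'', -⟩ := hmap θ hθ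
    obtain ⟨-, ht, T, X0, U0, U1, hf, hel⟩ := mem_explicitGroup_iff.1 hΦ'
    have hf' : ExplicitForm Φ.source φ T X0 U0 U1 :=
      ⟨hf.smooth_T, hf.smooth_X0, hf.deriv_ne, hf.U1_ne, fun p hp => by
        rw [← he hp]; exact hf.form p hp⟩
    -- Both `θ'` and the coefficients `θ''` supplied by the group property are the `Φ`-image of `θ`,
    -- so they coincide on the target.
    have agree : ∀ q ∈ base '' Φ.target,
        (θ'.A1 q, θ'.A2 q) = (θ''.A1 q, θ''.A2 q) := by
      rw [ht]
      rintro _ ⟨_, ⟨p, hp, rfl⟩, rfl⟩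
      exact (hc p hp).trans (hc'' p hp).symm
    refine ⟨d, d', hφ.congr he.symm, hθ, hC _ θ'' θ' (isOpenMap_base _ d'.isOpen) hθ''
      (fun q hq => congrArg Prod.fst (agree q hq)) (fun q hq => congrArg Prod.snd (agree q hq)),
      hf'.mapsEquation d fun p hp => ?_⟩
    rw [← he hp, hc p hp]
    exact hel _ ⟨hp, (hr _ (d.isConnected.nonempty.image _) hθ).1.2.2 _ (mem_image_of_mem _ hp)⟩

/-! ### The three classes -/

lemma wholeClass_congr {D : Set Plane} {θ θ' : Coeffs} (h : θ ∈ wholeClass D)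
    (h1 : ∀ q ∈ D, θ'.A1 q = θ.A1 q) (h2 : ∀ q ∈ D, θ'.A2 q = θ.A2 q) : θ' ∈ wholeClass D :=
  ⟨h.1.congr h1, h.2.1.congr h2, fun q hq => by rw [h2 q hq]; exact h.2.2 q hq⟩

lemma dx_dx_congr {D : Set Plane} (hD : IsOpen D) {f g : Plane → ℝ} (h : ∀ q ∈ D, f q = g q) :
    ∀ q ∈ D, dx (dx f) q = dx (dx g) q :=
  pd_congr hD (pd_congr hD h _) _

lemma strictlyRegularClass_subset {D : Set Plane} (hD : D.Nonempty) :
    strictlyRegularClass D ⊆ regularClass D := fun _ h =>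
  ⟨h.1, hD.choose, hD.choose_spec, h.2 _ hD.choose_spec⟩

theorem usualEquivGroup_wholeClass : usualEquivGroup wholeClass = explicitGroup :=
  Subset.antisymm
    (usualEquivGroup_subset_explicitGroup (fun _ => Subset.rfl) fun _ _ _ h => h.1)
    (explicitGroup_subset_usualEquivGroup (fun _ => Subset.rfl) fun _ _ _ _ _ h' _ => h')

theorem usualEquivGroup_regularClass : usualEquivGroup regularClass = explicitGroup := by
  refine Subset.antisymm
    (usualEquivGroup_subset_explicitGroup (fun _ _ h => h.1)
      fun _ hD => strictlyRegularClass_subset hD)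
    (explicitGroup_subset_usualEquivGroup (fun _ _ h => h.1) ?_)
  rintro Ω φ θ θ' ⟨-, _, ⟨p, hp, rfl⟩, hne⟩ h' hiff
  exact ⟨h', base (φ p), mem_image_of_mem _ (mem_image_of_mem _ hp), (hiff p hp).2 hne⟩

theorem usualEquivGroup_strictlyRegularClass :
    usualEquivGroup strictlyRegularClass = explicitGroup := by
  refine Subset.antisymm
    (usualEquivGroup_subset_explicitGroup (fun _ _ h => h.1) fun _ _ => Subset.rfl)
    (explicitGroup_subset_usualEquivGroup (fun _ _ h => h.1) ?_)
  refine fun Ω φ θ θ' h h' hiff => ⟨h', ?_⟩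
  rintro _ ⟨_, ⟨p, hp, rfl⟩, rfl⟩
  exact (hiff p hp).2 (h.2 _ (mem_image_of_mem _ hp))

theorem isNormalizedUsual_regularClass : IsNormalizedUsual regularClass := by
  refine isNormalizedUsual_of_eq_explicitGroup (fun _ _ => Subset.rfl) ?_
    usualEquivGroup_regularClass
  rintro D θ θ' hD ⟨h, q, hq, hne⟩ h1 h2
  exact ⟨wholeClass_congr h h1 h2, q, hq, by rwa [dx_dx_congr hD h1 q hq]⟩

theorem isNormalizedUsual_strictlyRegularClass : IsNormalizedUsual strictlyRegularClass := by
  refine isNormalizedUsual_of_eq_explicitGroup (fun _ hD => strictlyRegularClass_subset hD) ?_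
    usualEquivGroup_strictlyRegularClass
  rintro D θ θ' hD ⟨h, hne⟩ h1 h2
  exact ⟨wholeClass_congr h h1 h2, fun q hq => by
    rw [dx_dx_congr hD h1 q hq]; exact hne q hq⟩

end Burgers

theorem mainTheorem8 :
    (Burgers.IsNormalizedUsual Burgers.regularClass ∧
      Burgers.usualEquivGroup Burgers.regularClass =
        Burgers.usualEquivGroup Burgers.wholeClass) ∧
    (Burgers.IsNormalizedUsual Burgers.strictlyRegularClass ∧
      Burgers.usualEquivGroup Burgers.strictlyRegularClass =
        Burgers.usualEquivGroup Burgers.wholeClass) ∧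
    Burgers.usualEquivGroup Burgers.wholeClass = Burgers.explicitGroup :=
  ⟨⟨Burgers.isNormalizedUsual_regularClass, Burgers.usualEquivGroup_regularClass.trans
      Burgers.usualEquivGroup_wholeClass.symm⟩,
    ⟨Burgers.isNormalizedUsual_strictlyRegularClass,
      Burgers.usualEquivGroup_strictlyRegularClass.trans
        Burgers.usualEquivGroup_wholeClass.symm⟩,
    Burgers.usualEquivGroup_wholeClass⟩
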